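/- Let $n\ge 1$. Let $\mathcal U_{nc}(n)$ be Brown's algebra, i.e. the universal unital $C^*$-algebra generated by $n^2$ elements $u_{ij}$ ($1\le i,j\le n$) subject to the relation that the matrix $U=(u_{ij})\in M_n(\mathcal U_{nc}(n))$ is unitary, and let $$\mathcal V_n=\operatorname{span}\big(\{1\}\cup\{u_{ij}\}_{i,j}\cup\{u_{ij}^*\}_{i,j}\big)\subseteq \mathcal U_{nc}(n),$$ an operator subsystem of $\mathcal U_{nc}(n)$. Let $\varphi:M_{2n}\to\mathcal V_n$ be the linear map given on matrix units by $$\varphi(E_{ij})=\begin{cases}\frac1{2n}1 & i=j,\\ \frac1{2n}u_{i,j-n} & i\le n,\ j\ge n+1,\\ \frac1{2n}u_{j,i-n}^* & i\ge n+1,\ j\le n,\\ 0&\text{otherwise,}\end{cases}$$ and let $\mathcal J_{2n}=\ker\varphi$. The quotient of an operator system $\mathcal S$ by the kernel $\mathcal J$ of a unital completely positive (ucp) map is the $*$-vector space $\mathcal S/\mathcal J$ with unit $\dot 1=1+\mathcal J$ and with the matrix cones $C_k(\mathcal S,\mathcal J)$ of all self-adjoint $\dot X\in M_k(\mathcal S/\mathcal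 J)$ such that, for every $\varepsilon>0$, $\dot X+\varepsilon(I_k\otimes\dot 1)$ is the image of a positive element of $M_k(\mathcal S)$. A surjective ucp map $\mathcal S\to\mathcal T$ with kernel $\mathcal J$ is a complete quotient map if the induced map $\mathcal S/\mathcal J\to\mathcal T$ is a complete order isomorphism (a ucp bijection with ucp inverse). Then: 1. The map $\varphi:M_{2n}\to\mathcal V_n$ is ucp and is a complete quotient map; that is, the induced map $M_{2n}/\mathcal J_{2n}\to\mathcal V_n$ is a complete order isomorphism. 2. The $C^*$-envelope of $\mathcal V_n$ is $\mathcal U_{nc}(n)$, with the inclusion $\mathcal V_n\subseteq\mathcal U_{nc}(n)$: the inclusion is a unital complete order embedding whose range generates $\mathcal U_{nc}(n)$ as a $C^*$-algebra, and whenever $\mathcal A$ is a unital $C^*$-algebra and $\iota:\mathcal V_n\to\mathcal A$ is a unital complete order embedding whose range generates $\mathcal A$ as a $C^*$-algebra, there is a surjective unital $*$-homomorphism $\rho:\mathcal A\to\mathcal U_{nc}(n)$ with $\rho(\iota(v))=v$ for all $v\in\mathcal V_n$. -/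

import Mathlib

open scoped ComplexOrder

universe u v w

noncomputable section

/-! ## Free `*`-algebras -/

/-- The free unital complex `*`-algebra on a set `X`: finite linear combinations of words in the
letters `x` (`Sum.inl x`) and `x*` (`Sum.inr x`). -/
def FreeStarAlgebra (X : Type u) : Type u := MonoidAlgebra ℂ (FreeMonoid (X ⊕ X))

namespace FreeStarAlgebra

variable {X : Type u}

instance : Ring (FreeStarAlgebra X) :=
  inferInstanceAs (Ring (MonoidAlgebra ℂ (FreeMonoid (X ⊕ X))))

instance : Algebra ℂ (FreeStarAlgebra X) :=
  inferInstanceAs (Algebra ℂ (MonoidAlgebra ℂ (FreeMonoid (X ⊕ X))))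

/-- The adjoint of a word: reverse it and exchange the letters `x` and `x*`. -/
def wordStar (m : FreeMonoid (X ⊕ X)) : FreeMonoid (X ⊕ X) := star (FreeMonoid.map Sum.swap m)

/-- The scalar multiple `c • m` of a word `m`. -/
def mono (m : FreeMonoid (X ⊕ X)) (c : ℂ) : FreeStarAlgebra X := MonoidAlgebra.single m c

/-- The generator `x`. -/
def gen (x : X) : FreeStarAlgebra X := mono (FreeMonoid.of (Sum.inl x)) 1

/-- The conjugate-linear extension of `wordStar`. -/
def starHom : FreeStarAlgebra X →+ FreeStarAlgebra X where
  toFun a := MonoidAlgebra.ofCoeff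
    ((a.coeff.mapRange (starRingEnd ℂ) (map_zero _)).mapDomain wordStar)
  map_zero' := by
    change MonoidAlgebra.ofCoeff (Finsupp.mapDomain wordStar
      (Finsupp.mapRange (starRingEnd ℂ) _ 0)) = _
    rw [Finsupp.mapRange_zero, Finsupp.mapDomain_zero]; rfl
  map_add' a b := by
    change MonoidAlgebra.ofCoeff (Finsupp.mapDomain wordStar
      (Finsupp.mapRange (starRingEnd ℂ) _ (a.coeff + b.coeff))) = _
    rw [Finsupp.mapRange_add (fun x y => map_add _ x y), Finsupp.mapDomain_add]; rfl

theorem starHom_mono (m : FreeMonoid (X ⊕ X)) (c : ℂ) :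
    starHom (mono m c) = mono (wordStar m) (starRingEnd ℂ c) := by
  change MonoidAlgebra.ofCoeff (Finsupp.mapDomain wordStar
      (Finsupp.mapRange (starRingEnd ℂ) _ (Finsupp.single m c))) = _
  rw [Finsupp.mapRange_single, Finsupp.mapDomain_single]; rfl

theorem induction_lin {P : FreeStarAlgebra X → Prop} (h0 : P 0)
    (hadd : ∀ a b, P a → P b → P (a + b)) (hm : ∀ m c, P (mono m c)) (a : FreeStarAlgebra X) :
    P a :=
  MonoidAlgebra.induction_linear a h0 hadd hm

theorem mono_mul (m m' : FreeMonoid (X ⊕ X)) (c c' : ℂ) :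
    mono m c * mono m' c' = mono (m * m') (c * c') :=
  MonoidAlgebra.single_mul_single m m' c c'

theorem smul_mono (m : FreeMonoid (X ⊕ X)) (c c' : ℂ) :
    c • mono m c' = mono m (c * c') :=
  MonoidAlgebra.smul_single' c m c'

theorem wordStar_wordStar (m : FreeMonoid (X ⊕ X)) : wordStar (wordStar m) = m := by
  have h : ∀ l : List (X ⊕ X), (((l.map Sum.swap).reverse).map Sum.swap).reverse = l := by
    intro l
    rw [List.map_reverse, List.reverse_reverse, List.map_map, Sum.swap_swap_eq, List.map_id]
  exact h m

theorem wordStar_mul (m m' : FreeMonoid (X ⊕ X)) :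
    wordStar (m * m') = wordStar m' * wordStar m := by
  simp [wordStar]

instance : StarRing (FreeStarAlgebra X) where
  star := starHom
  star_involutive a := by
    refine induction_lin (P := fun a => starHom (starHom a) = a) ?_ ?_ ?_ a
    · simp
    · intro a b ha hb; simp [ha, hb]
    · intro m c; rw [starHom_mono, starHom_mono, wordStar_wordStar]; simp
  star_mul a b := by
    change starHom (a * b) = starHom b * starHom a
    refine induction_lin (P := fun a => starHom (a * b) = starHom b * starHom a) ?_ ?_ ?_ a
    · simp
    · intro a b ha hb; simp [add_mul, mul_add, ha, hb]
    · intro m c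
      refine induction_lin
        (P := fun b => starHom (mono m c * b) = starHom b * starHom (mono m c)) ?_ ?_ ?_ b
      · simp
      · intro a b ha hb; simp [add_mul, mul_add, ha, hb]
      · intro m' c'
        rw [mono_mul, starHom_mono, starHom_mono, starHom_mono, mono_mul, wordStar_mul, map_mul,
          mul_comm (starRingEnd ℂ c)]
  star_add a b := map_add starHom a b

theorem star_mono (m : FreeMonoid (X ⊕ X)) (c : ℂ) :
    star (mono m c) = mono (wordStar m) (starRingEnd ℂ c) := starHom_mono m c

instance : StarModule ℂ (FreeStarAlgebra X) where
  star_smul c a := by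
    refine induction_lin (P := fun a => star (c • a) = star c • star a) ?_ ?_ ?_ a
    · simp
    · intro a b ha hb; simp [ha, hb]
    · intro m c'
      rw [smul_mono, star_mono, star_mono, smul_mono, map_mul]; rfl

/-- A map from `X` to a `*`-algebra extends to a unital `*`-homomorphism. -/
def lift {B : Type v} [Ring B] [StarRing B] [Algebra ℂ B] [StarModule ℂ B] (f : X → B) :
    FreeStarAlgebra X →⋆ₐ[ℂ] B :=
  let g : FreeStarAlgebra X →ₐ[ℂ] B :=
    MonoidAlgebra.lift ℂ B _ (FreeMonoid.lift (Sum.elim f (fun x => star (f x))))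
  { toFun := fun a => g a
    map_one' := map_one g
    map_mul' := map_mul g
    map_zero' := map_zero g
    map_add' := map_add g
    commutes' := g.commutes
    map_star' := by
      have hg : ∀ m c, g (mono m c) = c • FreeMonoid.lift (Sum.elim f (fun x => star (f x))) m :=
        fun m c => MonoidAlgebra.lift_single _ _ _
      have hadd : ∀ a b : FreeStarAlgebra X, g (a + b) = g a + g b := map_add g
      have h0 : g (0 : FreeStarAlgebra X) = 0 := map_zero g
      intro a
      refine induction_lin (P := fun a => g (star a) = star (g a)) ?_ ?_ ?_ a
      · rw [star_zero, h0, star_zero]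
      · intro a b ha hb; rw [star_add, hadd, hadd, star_add, ha, hb]
      · intro m c
        rw [star_mono, hg, hg, star_smul]
        congr 1
        induction m using FreeMonoid.inductionOn' with
        | one => simp [wordStar]
        | of_mul x m ih =>
          rw [wordStar_mul, map_mul, ih, map_mul, star_mul]
          congr 1
          cases x <;> simp [wordStar] }

theorem lift_gen {B : Type v} [Ring B] [StarRing B] [Algebra ℂ B] [StarModule ℂ B] (f : X → B)
    (x : X) : lift f (gen x) = f x := by
  change MonoidAlgebra.lift ℂ B _ (FreeMonoid.lift (Sum.elim f (fun x => star (f x))))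
    (MonoidAlgebra.single (FreeMonoid.of (Sum.inl x)) 1) = f x
  simp

/-- The generators generate `FreeStarAlgebra X` as a `*`-algebra. -/
theorem adjoin_gen : StarAlgebra.adjoin ℂ (Set.range (gen : X → FreeStarAlgebra X)) = ⊤ := by
  rw [eq_top_iff]
  rintro a -
  refine induction_lin (P := fun a => a ∈ StarAlgebra.adjoin ℂ (Set.range gen))
    (zero_mem _) (fun a b => add_mem) ?_ a
  intro m c
  have : mono m c = c • mono m 1 := by rw [smul_mono, mul_one]
  rw [this]
  clear this
  refine Subalgebra.smul_mem (StarAlgebra.adjoin ℂ _).toSubalgebra ?_ c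
  change mono m 1 ∈ StarAlgebra.adjoin ℂ _
  induction m using FreeMonoid.inductionOn' with
  | one => exact one_mem _
  | of_mul x m ih =>
    have : mono (FreeMonoid.of x * m) 1 = mono (FreeMonoid.of x) 1 * mono m 1 := by
      rw [mono_mul, mul_one]
    rw [this]
    refine mul_mem ?_ ih
    cases x with
    | inl x => exact StarAlgebra.subset_adjoin ℂ _ ⟨x, rfl⟩
    | inr x =>
      have : mono (FreeMonoid.of (Sum.inr x)) 1 = star (gen x) := by
        rw [gen, star_mono]; simp [wordStar]
      rw [this]
      exact star_mem (StarAlgebra.subset_adjoin ℂ _ ⟨x, rfl⟩)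

end FreeStarAlgebra

/-! ## `C*`-seminorms and their completions -/

/-- A `C*`-seminorm on a complex `*`-algebra. -/
structure CStarSeminorm (F : Type u) [Ring F] [StarRing F] [Algebra ℂ F] extends
    RingSeminorm F where
  smul' : ∀ (c : ℂ) (a : F), toFun (c • a) = ‖c‖ * toFun a
  star_mul_self' : ∀ a : F, toFun (star a * a) = toFun a * toFun a

namespace CStarSeminorm

variable {F : Type u} [Ring F] [StarRing F] [Algebra ℂ F]

instance : CoeFun (CStarSeminorm F) (fun _ => F → ℝ) := ⟨fun p => p.toFun⟩

theorem nonneg (p : CStarSeminorm F) (a : F) : 0 ≤ p a := apply_nonneg p.toRingSeminorm a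

theorem mul_le (p : CStarSeminorm F) (a b : F) : p (a * b) ≤ p a * p b := p.mul_le' a b

theorem le_star (p : CStarSeminorm F) (a : F) : p a ≤ p (star a) := by
  have h := p.mul_le (star a) a
  rw [p.star_mul_self'] at h
  rcases (p.nonneg a).eq_or_lt with h0 | h0
  · rw [← h0]; exact p.nonneg _
  · exact le_of_mul_le_mul_right h h0

theorem apply_star (p : CStarSeminorm F) (a : F) : p (star a) = p a :=
  le_antisymm (by simpa using p.le_star (star a)) (p.le_star a)

theorem one_le (p : CStarSeminorm F) : p 1 ≤ 1 := by
  have h := p.star_mul_self' 1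
  rw [star_one, one_mul] at h
  nlinarith [p.nonneg 1, h]

/-- A type synonym of `F`, carrying the seminorm `p`. -/
def Pre (_p : CStarSeminorm F) : Type u := F

variable (p : CStarSeminorm F)

instance : SeminormedRing p.Pre := p.toRingSeminorm.toSeminormedRing

instance : Algebra ℂ p.Pre := (inferInstance : Algebra ℂ F)

instance : NormedAlgebra ℂ p.Pre where
  norm_smul_le c a := (p.smul' c a).le

instance : StarRing p.Pre := (inferInstance : StarRing F)

instance [StarModule ℂ F] : StarModule ℂ p.Pre := (inferInstance : StarModule ℂ F)

theorem norm_pre (a : p.Pre) : ‖a‖ = p a := rfl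

instance : NormedStarGroup p.Pre where
  norm_star_le a := (p.apply_star a).le

/-- The Hausdorff completion of `F` with respect to the `C*`-seminorm `p`. -/
def Completion : Type u := UniformSpace.Completion p.Pre

instance : NormedRing p.Completion := inferInstanceAs (NormedRing (UniformSpace.Completion p.Pre))

instance : CompleteSpace p.Completion :=
  inferInstanceAs (CompleteSpace (UniformSpace.Completion p.Pre))

instance : Algebra ℂ p.Completion :=
  inferInstanceAs (Algebra ℂ (UniformSpace.Completion p.Pre))

instance : NormedAlgebra ℂ p.Completion where
  norm_smul_le := (inferInstance : NormedSpace ℂ (UniformSpace.Completion p.Pre)).norm_smul_le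

/-- The canonical map from `F` to its completion. -/
def ofPre (a : F) : p.Completion := UniformSpace.Completion.coe' (α := p.Pre) a

theorem denseRange_ofPre : DenseRange p.ofPre :=
  UniformSpace.Completion.denseRange_coe (α := p.Pre)

theorem norm_ofPre (a : F) : ‖p.ofPre a‖ = p a := UniformSpace.Completion.norm_coe (E := p.Pre) a

theorem ofPre_add (a b : F) : p.ofPre (a + b) = p.ofPre a + p.ofPre b :=
  UniformSpace.Completion.coe_add (α := p.Pre) a b

theorem ofPre_mul (a b : F) : p.ofPre (a * b) = p.ofPre a * p.ofPre b :=
  UniformSpace.Completion.coe_mul (α := p.Pre) a b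

theorem ofPre_algebraMap (c : ℂ) : p.ofPre (algebraMap ℂ F c) = algebraMap ℂ p.Completion c := rfl

theorem ofPre_smul (c : ℂ) (a : F) : p.ofPre (c • a) = c • p.ofPre a := by
  rw [Algebra.smul_def, Algebra.smul_def, ofPre_mul, ofPre_algebraMap]

theorem induction {P : p.Completion → Prop} (hP : IsClosed {a | P a})
    (h : ∀ a : F, P (p.ofPre a)) (a : p.Completion) : P a :=
  p.denseRange_ofPre.induction_on a hP h

instance : Star p.Completion where
  star := UniformSpace.Completion.map (star : p.Pre → p.Pre)

theorem continuous_star' : Continuous (star : p.Completion → p.Completion) :=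
  UniformSpace.Completion.continuous_map

theorem star_ofPre (a : F) : star (p.ofPre a) = p.ofPre (star a) :=
  UniformSpace.Completion.map_coe (f := (star : p.Pre → p.Pre)) (by
    have : Isometry (star : p.Pre → p.Pre) := star_isometry
    exact this.uniformContinuous) a

instance : StarRing p.Completion where
  star_involutive a := by
    refine p.induction (P := fun a => star (star a) = a)
      (isClosed_eq (p.continuous_star'.comp p.continuous_star') continuous_id) ?_ a
    intro a; rw [star_ofPre, star_ofPre, star_star]
  star_mul a b := by
    have hs := p.continuous_star'
    refine p.induction (P := fun a => star (a * b) = star b * star a)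
      (isClosed_eq (by fun_prop) (by fun_prop)) ?_ a
    intro a
    refine p.induction (P := fun b => star (p.ofPre a * b) = star b * star (p.ofPre a))
      (isClosed_eq (by fun_prop) (by fun_prop)) ?_ b
    intro b
    rw [← ofPre_mul, star_ofPre, star_ofPre, star_ofPre, star_mul, ofPre_mul]
  star_add a b := by
    have hs := p.continuous_star'
    refine p.induction (P := fun a => star (a + b) = star a + star b)
      (isClosed_eq (by fun_prop) (by fun_prop)) ?_ a
    intro a
    refine p.induction (P := fun b => star (p.ofPre a + b) = star (p.ofPre a) + star b)
      (isClosed_eq (by fun_prop) (by fun_prop)) ?_ b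
    intro b
    rw [← ofPre_add, star_ofPre, star_ofPre, star_ofPre, star_add, ofPre_add]

instance : CStarRing p.Completion where
  norm_mul_self_le a := by
    have hs := p.continuous_star'
    refine p.induction (P := fun a => ‖a‖ * ‖a‖ ≤ ‖star a * a‖)
      (isClosed_le (by fun_prop) (by fun_prop)) ?_ a
    intro a
    rw [star_ofPre, ← ofPre_mul, norm_ofPre, norm_ofPre, p.star_mul_self']

instance [StarModule ℂ F] : StarModule ℂ p.Completion where
  star_smul c a := by
    have hs := p.continuous_star'
    refine p.induction (P := fun a => star (c • a) = star c • star a)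
      (isClosed_eq (hs.comp (continuous_const_smul c)) (hs.const_smul (star c))) ?_ a
    intro a
    rw [← ofPre_smul, star_ofPre, star_ofPre, star_smul, ofPre_smul]

instance [StarModule ℂ F] : CStarAlgebra p.Completion where

/-- The canonical `*`-homomorphism from `F` to its completion. -/
def ι : F →⋆ₐ[ℂ] p.Completion where
  toFun := p.ofPre
  map_one' := rfl
  map_mul' := p.ofPre_mul
  map_zero' := rfl
  map_add' := p.ofPre_add
  commutes' := p.ofPre_algebraMap
  map_star' a := (p.star_ofPre a).symm

theorem norm_ι (a : F) : ‖p.ι a‖ = p a := p.norm_ofPre a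

/-- The `C*`-seminorm induced by a `*`-homomorphism to a `C*`-algebra. -/
def ofHom {B : Type v} [CStarAlgebra B] (f : F →⋆ₐ[ℂ] B) : CStarSeminorm F where
  toFun a := ‖f a‖
  map_zero' := by simp
  add_le' a b := by rw [map_add]; exact norm_add_le _ _
  neg' a := by rw [map_neg, norm_neg]
  mul_le' a b := by rw [map_mul]; exact norm_mul_le _ _
  smul' c a := by rw [map_smul, norm_smul]
  star_mul_self' a := by rw [map_mul, map_star]; exact CStarRing.norm_star_mul_self

/-- A `*`-homomorphism to a `C*`-algebra that is bounded by `p` extends to the completion. -/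
theorem exists_extension {B : Type v} [CStarAlgebra B] (f : F →⋆ₐ[ℂ] B)
    (hf : ∀ a, ‖f a‖ ≤ p a) : ∃ g : p.Completion →⋆ₐ[ℂ] B, ∀ a, g (p.ι a) = f a := by
  have hu : UniformContinuous (fun a : p.Pre => f (show F from a)) := by
    refine AddMonoidHomClass.uniformContinuous_of_bound
      (AddMonoidHom.mk' (fun a : p.Pre => f (show F from a)) (fun a b => map_add f a b)) 1 ?_
    intro a; rw [one_mul]; exact hf a
  let g : p.Completion → B := UniformSpace.Completion.extension (fun a : p.Pre => f (show F from a))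
  have hg : Continuous g := UniformSpace.Completion.continuous_extension
  have hgι : ∀ a, g (p.ofPre a) = f a := fun a => UniformSpace.Completion.extension_coe hu a
  have hs := p.continuous_star'
  refine ⟨{ toFun := g, map_one' := ?_, map_mul' := ?_, map_zero' := ?_, map_add' := ?_,
            commutes' := ?_, map_star' := ?_ }, hgι⟩
  · exact (hgι 1).trans (map_one f)
  · intro a b
    refine p.induction (P := fun a => g (a * b) = g a * g b)
      (isClosed_eq (by fun_prop) (by fun_prop)) ?_ a
    intro a
    refine p.induction (P := fun b => g (p.ofPre a * b) = g (p.ofPre a) * g b)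
      (isClosed_eq (by fun_prop) (by fun_prop)) ?_ b
    intro b; rw [← ofPre_mul, hgι, hgι, hgι, map_mul]
  · exact (hgι 0).trans (map_zero f)
  · intro a b
    refine p.induction (P := fun a => g (a + b) = g a + g b)
      (isClosed_eq (by fun_prop) (by fun_prop)) ?_ a
    intro a
    refine p.induction (P := fun b => g (p.ofPre a + b) = g (p.ofPre a) + g b)
      (isClosed_eq (by fun_prop) (by fun_prop)) ?_ b
    intro b; rw [← ofPre_add, hgι, hgι, hgι, map_add]
  · intro c
    change g (algebraMap ℂ p.Completion c) = _
    rw [← ofPre_algebraMap, hgι, AlgHomClass.commutes]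
  · intro a
    refine p.induction (P := fun a => g (star a) = star (g a))
      (isClosed_eq (by fun_prop) (by fun_prop)) ?_ a
    intro a
    rw [star_ofPre, hgι, hgι, map_star]

end CStarSeminorm

/-! ## Brown's algebra -/

namespace Brown

/-- The matrix `(x_{ij})` of the generators of the free `*`-algebra on `n²` generators. -/
def genMatrix (n : ℕ) : Matrix (Fin n) (Fin n) (FreeStarAlgebra (Fin n × Fin n)) :=
  fun i j => FreeStarAlgebra.gen (i, j)

/-- The `C*`-seminorms on the free `*`-algebra on `x_{ij}` for which the matrix `(x_{ij})` is
unitary, i.e. which annihilate the entries of `x* x - 1` and of `x x* - 1`. -/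
def Admissible (n : ℕ) : Type :=
  {p : CStarSeminorm (FreeStarAlgebra (Fin n × Fin n)) //
    ∀ i j, p ((star (genMatrix n) * genMatrix n - 1) i j) = 0 ∧
      p ((genMatrix n * star (genMatrix n) - 1) i j) = 0}

instance (n : ℕ) : Nonempty (Admissible n) :=
  ⟨⟨{ (0 : RingSeminorm _) with
      smul' := fun c a => by change (0 : ℝ) = ‖c‖ * 0; simp
      star_mul_self' := fun a => by change (0 : ℝ) = 0 * 0; simp }, fun _ _ => ⟨rfl, rfl⟩⟩⟩

theorem map_genMatrix_mem_unitary {n : ℕ} {B : Type v} [CStarAlgebra B]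
    (f : FreeStarAlgebra (Fin n × Fin n) →⋆ₐ[ℂ] B)
    (h : ∀ i j, f ((star (genMatrix n) * genMatrix n - 1) i j) = 0 ∧
      f ((genMatrix n * star (genMatrix n) - 1) i j) = 0) :
    (genMatrix n).map f ∈ unitary (Matrix (Fin n) (Fin n) B) := by
  have h1 : ∀ i j, f ((1 : Matrix (Fin n) (Fin n) (FreeStarAlgebra (Fin n × Fin n))) i j)
      = (1 : Matrix (Fin n) (Fin n) B) i j := by
    intro i j; by_cases hij : i = j <;> simp [Matrix.one_apply, hij]
  rw [Unitary.mem_iff]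
  constructor
  · ext i j
    have := (h i j).1
    rw [Matrix.sub_apply, map_sub, sub_eq_zero, h1] at this
    rw [← this]
    simp [Matrix.mul_apply, Matrix.star_apply, map_star]
  · ext i j
    have := (h i j).2
    rw [Matrix.sub_apply, map_sub, sub_eq_zero, h1] at this
    rw [← this]
    simp [Matrix.mul_apply, Matrix.star_apply, map_star]

theorem norm_entry_le_one {n : ℕ} {B : Type v} [CStarAlgebra B] {W : Matrix (Fin n) (Fin n) B}
    (hW : W ∈ unitary (Matrix (Fin n) (Fin n) B)) (i j : Fin n) : ‖W i j‖ ≤ 1 := by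
  let _ : PartialOrder B := CStarAlgebra.spectralOrder B
  have _ : StarOrderedRing B := CStarAlgebra.spectralOrderedRing B
  have hW' : CStarMatrix.ofMatrix W ∈ unitary (CStarMatrix (Fin n) (Fin n) B) := hW
  refine (CStarMatrix.norm_entry_le_norm (M := CStarMatrix.ofMatrix W)).trans ?_
  rcases subsingleton_or_nontrivial (CStarMatrix (Fin n) (Fin n) B) with h | h
  · rw [Subsingleton.elim (CStarMatrix.ofMatrix W) 0, norm_zero]; exact zero_le_one
  · exact (CStarRing.norm_of_mem_unitary hW').le

theorem Admissible.gen_le_one {n : ℕ} (p : Admissible n) (x : Fin n × Fin n) :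
    p.1 (FreeStarAlgebra.gen x) ≤ 1 := by
  have hz : ∀ a, p.1 a = 0 → p.1.ι a = 0 := fun a ha => by
    rw [← norm_eq_zero, p.1.norm_ι, ha]
  have := norm_entry_le_one (map_genMatrix_mem_unitary p.1.ι
    (fun i j => ⟨hz _ (p.2 i j).1, hz _ (p.2 i j).2⟩)) x.1 x.2
  rwa [Matrix.map_apply, p.1.norm_ι] at this

theorem Admissible.bddAbove (n : ℕ) (a : FreeStarAlgebra (Fin n × Fin n)) :
    BddAbove (Set.range fun p : Admissible n => p.1 a) := by
  suffices h : ∃ M, ∀ p : Admissible n, p.1 a ≤ M by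
    obtain ⟨M, hM⟩ := h
    exact ⟨M, by rintro _ ⟨p, rfl⟩; exact hM p⟩
  have ha : a ∈ StarAlgebra.adjoin ℂ (Set.range FreeStarAlgebra.gen) := by
    rw [FreeStarAlgebra.adjoin_gen]; trivial
  induction ha using StarAlgebra.adjoin_induction with
  | mem x hx =>
    obtain ⟨y, rfl⟩ := hx
    exact ⟨1, fun p => p.gen_le_one y⟩
  | algebraMap c =>
    refine ⟨‖c‖, fun p => ?_⟩
    rw [Algebra.algebraMap_eq_smul_one, p.1.smul']
    exact mul_le_of_le_one_right (norm_nonneg c) p.1.one_le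
  | add x y _ _ hx hy =>
    obtain ⟨M, hM⟩ := hx
    obtain ⟨N, hN⟩ := hy
    exact ⟨M + N, fun p => (p.1.add_le' x y).trans (add_le_add (hM p) (hN p))⟩
  | mul x y _ _ hx hy =>
    obtain ⟨M, hM⟩ := hx
    obtain ⟨N, hN⟩ := hy
    exact ⟨M * N, fun p => (p.1.mul_le x y).trans (mul_le_mul (hM p) (hN p) (p.1.nonneg y)
      ((p.1.nonneg x).trans (hM p)))⟩
  | star x _ hx =>
    obtain ⟨M, hM⟩ := hx
    exact ⟨M, fun p => (p.1.apply_star x).trans_le (hM p)⟩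

/-- The largest `C*`-seminorm on the free `*`-algebra on `x_{ij}` for which `(x_{ij})` is
unitary. -/
def maxSeminorm (n : ℕ) : CStarSeminorm (FreeStarAlgebra (Fin n × Fin n)) where
  toFun a := ⨆ p : Admissible n, p.1 a
  map_zero' := by
    have : ∀ p : Admissible n, p.1 0 = 0 := fun p => p.1.map_zero'
    simp only [this, ciSup_const]
  add_le' a b := ciSup_le fun p => (p.1.add_le' a b).trans
    (add_le_add (le_ciSup (Admissible.bddAbove n a) p) (le_ciSup (Admissible.bddAbove n b) p))
  neg' a := iSup_congr fun p => p.1.neg' a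
  mul_le' a b := ciSup_le fun p => (p.1.mul_le a b).trans
    (mul_le_mul (le_ciSup (Admissible.bddAbove n a) p) (le_ciSup (Admissible.bddAbove n b) p)
      (p.1.nonneg b) (Real.iSup_nonneg fun p => p.1.nonneg a))
  smul' c a := by
    rw [Real.mul_iSup_of_nonneg (norm_nonneg c)]
    exact iSup_congr fun p => p.1.smul' c a
  star_mul_self' a := by
    have h0 : 0 ≤ ⨆ p : Admissible n, p.1 a := Real.iSup_nonneg fun p => p.1.nonneg a
    apply le_antisymm
    · refine ciSup_le fun p => ?_
      rw [p.1.star_mul_self']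
      exact mul_self_le_mul_self (p.1.nonneg a) (le_ciSup (Admissible.bddAbove n a) p)
    · rw [← Real.sqrt_le_sqrt_iff (Real.iSup_nonneg fun p => p.1.nonneg _),
        Real.sqrt_mul_self h0]
      refine ciSup_le fun p => ?_
      refine Real.le_sqrt_of_sq_le ?_
      rw [sq, ← p.1.star_mul_self']
      exact le_ciSup (Admissible.bddAbove n (star a * a)) p

theorem le_maxSeminorm {n : ℕ} (p : Admissible n) (a : FreeStarAlgebra (Fin n × Fin n)) :
    p.1 a ≤ maxSeminorm n a := le_ciSup (Admissible.bddAbove n a) p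

/-- Brown's universal unitary `C*`-algebra `U_nc(n)`: the completion of the free `*`-algebra on
`n²` generators `x_{ij}` in the largest `C*`-seminorm for which the matrix `(x_{ij})` is
unitary. -/
def Unc (n : ℕ) : Type := (maxSeminorm n).Completion

instance (n : ℕ) : CStarAlgebra (Unc n) := inferInstanceAs (CStarAlgebra (maxSeminorm n).Completion)

/-- The canonical `*`-homomorphism from the free `*`-algebra to `U_nc(n)`. -/
def toUnc (n : ℕ) : FreeStarAlgebra (Fin n × Fin n) →⋆ₐ[ℂ] Unc n := (maxSeminorm n).ι

/-- The matrix `U = (u_{ij})` of the canonical generators of `U_nc(n)`. -/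
def u (n : ℕ) : Matrix (Fin n) (Fin n) (Unc n) :=
  fun i j => toUnc n (FreeStarAlgebra.gen (i, j))

/-- The matrix of generators is unitary. -/
theorem u_mem_unitary (n : ℕ) : u n ∈ unitary (Matrix (Fin n) (Fin n) (Unc n)) := by
  have hz : ∀ a, (∀ p : Admissible n, p.1 a = 0) → (maxSeminorm n).ι a = 0 := fun a ha => by
    rw [← norm_eq_zero, CStarSeminorm.norm_ι]
    change (⨆ p : Admissible n, p.1 a) = 0
    simp only [ha, ciSup_const]
  exact map_genMatrix_mem_unitary (maxSeminorm n).ι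
    (fun i j => ⟨hz _ fun p => (p.2 i j).1, hz _ fun p => (p.2 i j).2⟩)

/-- `U_nc(n)` is generated by the `u_{ij}` as a `C*`-algebra. -/
theorem adjoin_u (n : ℕ) : (StarAlgebra.adjoin ℂ
    (Set.range fun x : Fin n × Fin n => u n x.1 x.2)).topologicalClosure = ⊤ := by
  rw [eq_top_iff]
  rintro a -
  have hd : DenseRange (toUnc n) := (maxSeminorm n).denseRange_ofPre
  refine hd.induction_on (p := fun a => a ∈ (StarAlgebra.adjoin ℂ
      (Set.range fun x : Fin n × Fin n => u n x.1 x.2)).topologicalClosure) a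
    (StarSubalgebra.isClosed_topologicalClosure _) (fun b => ?_)
  refine StarSubalgebra.le_topologicalClosure _ ?_
  have hb : b ∈ StarAlgebra.adjoin ℂ (Set.range FreeStarAlgebra.gen) := by
    rw [FreeStarAlgebra.adjoin_gen]; trivial
  induction hb using StarAlgebra.adjoin_induction with
  | mem x hx =>
    obtain ⟨y, rfl⟩ := hx
    exact StarAlgebra.subset_adjoin ℂ _ ⟨y, rfl⟩
  | algebraMap c =>
    rw [AlgHomClass.commutes]
    exact algebraMap_mem (StarAlgebra.adjoin ℂ (Set.range fun x : Fin n × Fin n => u n x.1 x.2)) c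
  | add x y _ _ hx hy => rw [map_add]; exact add_mem hx hy
  | mul x y _ _ hx hy => rw [map_mul]; exact mul_mem hx hy
  | star x _ hx => rw [map_star]; exact star_mem hx

/-- The universal property of `U_nc(n)`. -/
theorem exists_lift {n : ℕ} {B : Type v} [CStarAlgebra B] {W : Matrix (Fin n) (Fin n) B}
    (hW : W ∈ unitary (Matrix (Fin n) (Fin n) B)) :
    ∃ π : Unc n →⋆ₐ[ℂ] B, ∀ i j, π (u n i j) = W i j := by
  let f : FreeStarAlgebra (Fin n × Fin n) →⋆ₐ[ℂ] B := FreeStarAlgebra.lift fun x => W x.1 x.2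
  have hf : ∀ i j, f (genMatrix n i j) = W i j := fun i j => FreeStarAlgebra.lift_gen _ (i, j)
  have h1 : ∀ i j, f ((1 : Matrix (Fin n) (Fin n) (FreeStarAlgebra (Fin n × Fin n))) i j)
      = (1 : Matrix (Fin n) (Fin n) B) i j := by
    intro i j; by_cases hij : i = j <;> simp [Matrix.one_apply, hij]
  rw [Unitary.mem_iff] at hW
  let p : Admissible n := ⟨CStarSeminorm.ofHom f, fun i j => by
    constructor
    · change ‖f _‖ = 0
      rw [norm_eq_zero, Matrix.sub_apply, map_sub, h1, sub_eq_zero, ← hW.1]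
      simp [Matrix.mul_apply, Matrix.star_apply, map_star, hf]
    · change ‖f _‖ = 0
      rw [norm_eq_zero, Matrix.sub_apply, map_sub, h1, sub_eq_zero, ← hW.2]
      simp [Matrix.mul_apply, Matrix.star_apply, map_star, hf]⟩
  obtain ⟨g, hg⟩ := CStarSeminorm.exists_extension (maxSeminorm n) f (le_maxSeminorm p)
  exact ⟨g, fun i j => (hg (genMatrix n i j)).trans (hf i j)⟩

end Brown

/-! ## Operator systems -/

section Compression

variable {S : Type u} [AddCommGroup S] [Module ℂ S] {k m : ℕ}

/-- The matrix `A* X A ∈ M_m(S)`, for `X ∈ M_k(S)` and a scalar matrix `A ∈ M_{k,m}(ℂ)`. -/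
def compression (A : Matrix (Fin k) (Fin m) ℂ) (X : Matrix (Fin k) (Fin k) S) :
    Matrix (Fin m) (Fin m) S :=
  fun i j => ∑ p, ∑ q, (star (A p i) * A q j) • X p q

theorem compression_add (A : Matrix (Fin k) (Fin m) ℂ) (X Y : Matrix (Fin k) (Fin k) S) :
    compression A (X + Y) = compression A X + compression A Y := by
  ext i j; simp [compression, Finset.sum_add_distrib]

theorem compression_smul (A : Matrix (Fin k) (Fin m) ℂ) (c : ℂ) (X : Matrix (Fin k) (Fin k) S) :
    compression A (c • X) = c • compression A X := by
  ext i j; simp [compression, Finset.smul_sum, smul_comm c]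

theorem map_compression {T : Type v} [AddCommGroup T] [Module ℂ T] (f : S →ₗ[ℂ] T)
    (A : Matrix (Fin k) (Fin m) ℂ) (X : Matrix (Fin k) (Fin k) S) :
    (compression A X).map f = compression A (X.map f) := by
  ext i j; simp [compression]

end Compression

/-- An (abstract) operator system structure on a complex `*`-vector space `S`: a matrix ordering
`{C_k}` together with an Archimedean matrix order unit `e`. -/
class OperatorSystem (S : Type u) [AddCommGroup S] [Module ℂ S] [StarAddMonoid S]
    [StarModule ℂ S] where
  /-- The cone `C_k` of positive elements of `M_k(S)`. -/
  cone : (k : ℕ) → Set (Matrix (Fin k) (Fin k) S)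
  /-- The order unit. -/
  e : S
  star_eq_of_mem : ∀ {k : ℕ} {X : Matrix (Fin k) (Fin k) S}, X ∈ cone k → star X = X
  add_mem : ∀ {k : ℕ} {X Y : Matrix (Fin k) (Fin k) S},
    X ∈ cone k → Y ∈ cone k → X + Y ∈ cone k
  smul_mem : ∀ {k : ℕ} {X : Matrix (Fin k) (Fin k) S} {t : ℝ},
    0 ≤ t → X ∈ cone k → (t : ℂ) • X ∈ cone k
  compression_mem : ∀ {k m : ℕ} (A : Matrix (Fin k) (Fin m) ℂ) {X : Matrix (Fin k) (Fin k) S},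
    X ∈ cone k → compression A X ∈ cone m
  eq_zero_of_mem_of_neg_mem : ∀ {k : ℕ} {X : Matrix (Fin k) (Fin k) S},
    X ∈ cone k → -X ∈ cone k → X = 0
  star_e : star e = e
  exists_add_mem : ∀ {k : ℕ} {X : Matrix (Fin k) (Fin k) S}, star X = X →
    ∃ r : ℝ, 0 < r ∧ X + (r : ℂ) • Matrix.diagonal (fun _ => e) ∈ cone k
  archimedean : ∀ {k : ℕ} {X : Matrix (Fin k) (Fin k) S}, star X = X →
    (∀ r : ℝ, 0 < r → X + (r : ℂ) • Matrix.diagonal (fun _ => e) ∈ cone k) → X ∈ cone k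

namespace OperatorSystem

variable {S : Type u} [AddCommGroup S] [Module ℂ S] [StarAddMonoid S] [StarModule ℂ S]
  [OperatorSystem S]
  {T : Type v} [AddCommGroup T] [Module ℂ T] [StarAddMonoid T] [StarModule ℂ T]
  [OperatorSystem T]

variable (S) in
/-- The order unit `I_k` of `M_k(S)`. -/
def unitMatrix (k : ℕ) : Matrix (Fin k) (Fin k) S := Matrix.diagonal (fun _ => e)

theorem unitMatrix_mem (k : ℕ) : unitMatrix S k ∈ cone k := by
  obtain ⟨r, hr, h⟩ := exists_add_mem (S := S) (k := k) (X := 0) (star_zero _)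
  have h2 := smul_mem (inv_nonneg.mpr hr.le) h
  rw [zero_add, smul_smul, ← Complex.ofReal_mul, inv_mul_cancel₀ hr.ne', Complex.ofReal_one,
    one_smul] at h2
  exact h2

theorem star_unitMatrix (k : ℕ) : star (unitMatrix S k) = unitMatrix S k :=
  star_eq_of_mem (unitMatrix_mem k)

end OperatorSystem

open OperatorSystem

section Maps

variable {S : Type u} [AddCommGroup S] [Module ℂ S] [StarAddMonoid S] [StarModule ℂ S]
  [OperatorSystem S]
  {T : Type v} [AddCommGroup T] [Module ℂ T] [StarAddMonoid T] [StarModule ℂ T]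
  [OperatorSystem T]

/-- Unital completely positive maps. -/
def IsUCP (f : S →ₗ[ℂ] T) : Prop :=
  f e = e ∧ ∀ (k : ℕ) (X : Matrix (Fin k) (Fin k) S), X ∈ cone k → X.map f ∈ cone k

/-- Complete order isomorphisms: ucp bijections with ucp inverse. -/
def IsCompleteOrderIso (f : S →ₗ[ℂ] T) : Prop :=
  ∃ g : S ≃ₗ[ℂ] T, g.toLinearMap = f ∧ IsUCP g.toLinearMap ∧ IsUCP g.symm.toLinearMap

theorem IsUCP.map_unitMatrix {f : S →ₗ[ℂ] T} (hf : IsUCP f) (k : ℕ) :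
    (unitMatrix S k).map f = unitMatrix T k := by
  ext i j
  by_cases h : i = j <;> simp [unitMatrix, h, hf.1]

theorem IsUCP.map_star {f : S →ₗ[ℂ] T} (hf : IsUCP f) (x : S) : f (star x) = star (f x) := by
  have key : ∀ y : S, star y = y → star (f y) = f y := by
    intro y hy
    have hY : star (Matrix.diagonal (fun _ : Fin 1 => y)) = Matrix.diagonal (fun _ => y) := by
      rw [Matrix.star_eq_conjTranspose, Matrix.diagonal_conjTranspose]
      congr 1; ext; exact hy
    obtain ⟨r, -, h⟩ := exists_add_mem hY
    have h2 := congrFun (congrFun (star_eq_of_mem (hf.2 1 _ h)) 0) 0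
    have h3 : star (f y) + (r : ℂ) • (e : T) = f y + (r : ℂ) • (e : T) := by
      simpa [Matrix.star_apply, hf.1, star_e] using h2
    exact add_right_cancel h3
  have hre := key (x + star x) (by simp [add_comm])
  have him := key (Complex.I • (x - star x)) (by
    rw [star_smul, star_sub, star_star, RCLike.star_def, Complex.conj_I, neg_smul, ← smul_neg,
      neg_sub])
  simp only [map_add, map_sub, map_smul, star_add, star_sub, star_smul, RCLike.star_def,
    Complex.conj_I, neg_smul] at hre him
  rw [← smul_neg] at him
  have him' := smul_right_injective T Complex.I_ne_zero him
  rw [neg_sub] at him'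
  have h2 : (2 : ℂ) • star (f x) = (2 : ℂ) • f (star x) := by
    rw [two_smul, two_smul]
    have := congrArg₂ (fun a b => a - b) hre him'
    beta_reduce at this
    have e1 : star (f x) + star (f (star x)) - (star (f (star x)) - star (f x))
        = star (f x) + star (f x) := by abel
    have e2 : f x + f (star x) - (f x - f (star x)) = f (star x) + f (star x) := by abel
    rw [← e1, ← e2]; exact this
  exact (smul_right_injective T (two_ne_zero : (2 : ℂ) ≠ 0) h2).symm

end Maps

/-! ### Operator subsystems -/

/-- An operator subsystem of `S`: a self-adjoint subspace that contains the order unit. -/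
structure OperatorSubsystem (S : Type u) [AddCommGroup S] [Module ℂ S] [StarAddMonoid S]
    [StarModule ℂ S] [OperatorSystem S] extends Submodule ℂ S where
  star_mem' : ∀ {x : S}, x ∈ carrier → star x ∈ carrier
  e_mem' : (e : S) ∈ carrier

namespace OperatorSubsystem

variable {S : Type u} [AddCommGroup S] [Module ℂ S] [StarAddMonoid S] [StarModule ℂ S]
  [OperatorSystem S] (V : OperatorSubsystem S)

instance : StarAddMonoid V.toSubmodule where
  star x := ⟨star x.1, V.star_mem' x.2⟩
  star_involutive x := Subtype.ext (star_star x.1)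
  star_add x y := Subtype.ext (star_add x.1 y.1)

theorem coe_star (x : V.toSubmodule) : ((star x : V.toSubmodule) : S) = star (x : S) := rfl

instance : StarModule ℂ V.toSubmodule where
  star_smul c x := Subtype.ext (star_smul c x.1)

theorem map_val_injective (k : ℕ) : Function.Injective
    (fun X : Matrix (Fin k) (Fin k) V.toSubmodule => X.map (Subtype.val : _ → S)) :=
  Matrix.map_injective Subtype.val_injective

theorem map_val_compression {k m : ℕ} (A : Matrix (Fin k) (Fin m) ℂ)
    (X : Matrix (Fin k) (Fin k) V.toSubmodule) :
    (compression A X).map (Subtype.val : _ → S) = compression A (X.map Subtype.val) :=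
  map_compression V.toSubmodule.subtype A X

theorem map_val_add_smul_diagonal {k : ℕ} (X : Matrix (Fin k) (Fin k) V.toSubmodule) (c : ℂ) :
    (X + c • Matrix.diagonal (fun _ => (⟨e, V.e_mem'⟩ : V.toSubmodule))).map
      (Subtype.val : _ → S) = X.map Subtype.val + c • Matrix.diagonal (fun _ => e) := by
  ext i j
  by_cases h : i = j <;> simp [h]

theorem star_map_val {k : ℕ} (X : Matrix (Fin k) (Fin k) V.toSubmodule) :
    (star X).map (Subtype.val : _ → S) = star (X.map Subtype.val) := rfl

/-- The matrix ordering of a subsystem is the restriction of that of the ambient system. -/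
instance : OperatorSystem V.toSubmodule where
  cone k := {X | X.map (Subtype.val : _ → S) ∈ cone k}
  e := ⟨e, V.e_mem'⟩
  star_eq_of_mem h := V.map_val_injective _ (star_eq_of_mem (S := S) h)
  add_mem hX hY := OperatorSystem.add_mem (S := S) hX hY
  smul_mem ht hX := OperatorSystem.smul_mem (S := S) ht hX
  compression_mem A X hX := by
    change (compression A X).map _ ∈ cone (S := S) _
    rw [map_val_compression]
    exact compression_mem A hX
  eq_zero_of_mem_of_neg_mem h h' :=
    V.map_val_injective _ (eq_zero_of_mem_of_neg_mem (S := S) h h')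
  star_e := Subtype.ext star_e
  exists_add_mem {k X} hX := by
    have hX' : star (X.map (Subtype.val : _ → S)) = X.map Subtype.val := by
      rw [← star_map_val, hX]
    obtain ⟨r, hr, h⟩ := exists_add_mem hX'
    refine ⟨r, hr, ?_⟩
    rw [← map_val_add_smul_diagonal] at h
    exact h
  archimedean {k X} hX h := by
    have hX' : star (X.map (Subtype.val : _ → S)) = X.map Subtype.val := by
      rw [← star_map_val, hX]
    refine archimedean hX' fun r hr => ?_
    rw [← map_val_add_smul_diagonal]
    exact h r hr

end OperatorSubsystem

/-- Complete order embeddings: complete order isomorphisms onto an operator subsystem. -/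
def IsCompleteOrderEmbedding {S : Type u} [AddCommGroup S] [Module ℂ S] [StarAddMonoid S]
    [StarModule ℂ S] [OperatorSystem S] {T : Type v} [AddCommGroup T] [Module ℂ T]
    [StarAddMonoid T] [StarModule ℂ T] [OperatorSystem T] (f : S →ₗ[ℂ] T) : Prop :=
  ∃ (T₁ : OperatorSubsystem T) (h : ∀ x, f x ∈ T₁.toSubmodule),
    IsCompleteOrderIso (f.codRestrict T₁.toSubmodule h)

/-! ### Quotients -/

/-- The quotient vector space `S / J`, where `J` is the kernel of the ucp map `f`. -/
def OSQuotient {S : Type u} [AddCommGroup S] [Module ℂ S] [StarAddMonoid S]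
    [StarModule ℂ S] [OperatorSystem S] {T : Type v} [AddCommGroup T] [Module ℂ T]
    [StarAddMonoid T] [StarModule ℂ T] [OperatorSystem T] (f : S →ₗ[ℂ] T) (_hf : IsUCP f) :
    Type u :=
  S ⧸ LinearMap.ker f

namespace OSQuotient

variable {S : Type u} [AddCommGroup S] [Module ℂ S] [StarAddMonoid S] [StarModule ℂ S]
  [OperatorSystem S]
  {T : Type v} [AddCommGroup T] [Module ℂ T] [StarAddMonoid T] [StarModule ℂ T]
  [OperatorSystem T] (f : S →ₗ[ℂ] T) (hf : IsUCP f)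

instance : AddCommGroup (OSQuotient f hf) := inferInstanceAs (AddCommGroup (S ⧸ LinearMap.ker f))

instance : Module ℂ (OSQuotient f hf) := inferInstanceAs (Module ℂ (S ⧸ LinearMap.ker f))

/-- The quotient map `q : S → S / J`. -/
def mk : S →ₗ[ℂ] OSQuotient f hf := (LinearMap.ker f).mkQ

/-- The map `S / J → T` induced by `f`. -/
def induced : OSQuotient f hf →ₗ[ℂ] T := (LinearMap.ker f).liftQ f le_rfl

theorem mk_surjective : Function.Surjective (mk f hf) := Submodule.mkQ_surjective _

theorem induced_mk (x : S) : induced f hf (mk f hf x) = f x := rfl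

theorem induced_injective : Function.Injective (induced f hf) :=
  LinearMap.ker_eq_bot.mp (Submodule.ker_liftQ_eq_bot _ _ _ le_rfl)

/-- The involution `(x + J)* = x* + J`. -/
def starMap : OSQuotient f hf →ₗ⋆[ℂ] OSQuotient f hf :=
  Submodule.mapQ (LinearMap.ker f) (LinearMap.ker f) (starLinearEquiv ℂ : S ≃ₗ⋆[ℂ] S).toLinearMap
    (fun x hx => by
      rw [Submodule.mem_comap, LinearMap.mem_ker] at *
      change f (star x) = 0
      rw [hf.map_star, hx, star_zero])

instance : Star (OSQuotient f hf) := ⟨starMap f hf⟩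

theorem star_mk (x : S) : star (mk f hf x) = mk f hf (star x) := rfl

instance : StarAddMonoid (OSQuotient f hf) where
  star_involutive x := by
    obtain ⟨x, rfl⟩ := mk_surjective f hf x
    rw [star_mk, star_mk, star_star]
  star_add x y := map_add (starMap f hf) x y

instance : StarModule ℂ (OSQuotient f hf) where
  star_smul c x := by
    obtain ⟨x, rfl⟩ := mk_surjective f hf x
    rw [← map_smul, star_mk, star_mk, star_smul, map_smul]

theorem induced_star (x : OSQuotient f hf) : induced f hf (star x) = star (induced f hf x) := by
  obtain ⟨x, rfl⟩ := mk_surjective f hf x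
  rw [star_mk, induced_mk, induced_mk, hf.map_star]

/-- The set `D_k` of the images of the positive elements of `M_k(S)`. -/
def preCone (k : ℕ) : Set (Matrix (Fin k) (Fin k) (OSQuotient f hf)) :=
  {X | ∃ Y ∈ cone (S := S) k, Y.map (mk f hf) = X}

/-- The order unit of `M_k(S / J)`. -/
def quotientUnit (k : ℕ) : Matrix (Fin k) (Fin k) (OSQuotient f hf) :=
  Matrix.diagonal (fun _ => mk f hf e)

/-- The Archimedeanization `C_k` of `D_k`. -/
def quotientCone (k : ℕ) : Set (Matrix (Fin k) (Fin k) (OSQuotient f hf)) :=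
  {X | star X = X ∧ ∀ ε : ℝ, 0 < ε → X + (ε : ℂ) • quotientUnit f hf k ∈ preCone f hf k}

theorem map_mk_add {k : ℕ} (X Y : Matrix (Fin k) (Fin k) S) :
    (X + Y).map (mk f hf) = X.map (mk f hf) + Y.map (mk f hf) := by
  ext i j; simp

theorem map_mk_smul {k : ℕ} (c : ℂ) (X : Matrix (Fin k) (Fin k) S) :
    (c • X).map (mk f hf) = c • X.map (mk f hf) := by
  ext i j; simp

theorem map_mk_unit (k : ℕ) : (unitMatrix S k).map (mk f hf) = quotientUnit f hf k := by
  ext i j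
  by_cases h : i = j <;> simp [unitMatrix, quotientUnit, h]

theorem map_mk_star {k : ℕ} (X : Matrix (Fin k) (Fin k) S) :
    (star X).map (mk f hf) = star (X.map (mk f hf)) := rfl

theorem exists_map_mk {k : ℕ} (X : Matrix (Fin k) (Fin k) (OSQuotient f hf)) :
    ∃ Y : Matrix (Fin k) (Fin k) S, Y.map (mk f hf) = X :=
  ⟨fun i j => (mk_surjective f hf (X i j)).choose, by
    ext i j; exact (mk_surjective f hf (X i j)).choose_spec⟩

variable {f hf}

theorem preCone_add {k : ℕ} {X Y : Matrix (Fin k) (Fin k) (OSQuotient f hf)}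
    (hX : X ∈ preCone f hf k) (hY : Y ∈ preCone f hf k) : X + Y ∈ preCone f hf k := by
  obtain ⟨X', hX', rfl⟩ := hX
  obtain ⟨Y', hY', rfl⟩ := hY
  exact ⟨X' + Y', add_mem hX' hY', map_mk_add f hf X' Y'⟩

theorem preCone_smul {k : ℕ} {X : Matrix (Fin k) (Fin k) (OSQuotient f hf)} {t : ℝ}
    (ht : 0 ≤ t) (hX : X ∈ preCone f hf k) : (t : ℂ) • X ∈ preCone f hf k := by
  obtain ⟨X', hX', rfl⟩ := hX
  exact ⟨(t : ℂ) • X', smul_mem ht hX', map_mk_smul f hf _ X'⟩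

theorem unit_mem_preCone (k : ℕ) : quotientUnit f hf k ∈ preCone f hf k :=
  ⟨unitMatrix S k, unitMatrix_mem k, map_mk_unit f hf k⟩

theorem star_eq_of_mem_preCone {k : ℕ} {X : Matrix (Fin k) (Fin k) (OSQuotient f hf)}
    (hX : X ∈ preCone f hf k) : star X = X := by
  obtain ⟨X', hX', rfl⟩ := hX
  rw [← map_mk_star, star_eq_of_mem hX']

theorem preCone_subset {k : ℕ} {X : Matrix (Fin k) (Fin k) (OSQuotient f hf)}
    (hX : X ∈ preCone f hf k) : X ∈ quotientCone f hf k :=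
  ⟨star_eq_of_mem_preCone hX,
    fun _ hε => preCone_add hX (preCone_smul hε.le (unit_mem_preCone k))⟩

theorem compression_mem_preCone {k m : ℕ} (A : Matrix (Fin k) (Fin m) ℂ)
    {X : Matrix (Fin k) (Fin k) (OSQuotient f hf)} (hX : X ∈ preCone f hf k) :
    compression A X ∈ preCone f hf m := by
  obtain ⟨X', hX', rfl⟩ := hX
  exact ⟨compression A X', compression_mem A hX', map_compression (mk f hf) A X'⟩

theorem star_compression {R : Type w} [AddCommGroup R] [Module ℂ R] [StarAddMonoid R]
    [StarModule ℂ R] {k m : ℕ} (A : Matrix (Fin k) (Fin m) ℂ) (X : Matrix (Fin k) (Fin k) R) :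
    star (compression A X) = compression A (star X) := by
  ext i j
  simp only [compression, Matrix.star_apply, star_sum, star_smul, star_mul', star_star]
  rw [Finset.sum_comm]
  simp only [mul_comm]

theorem map_induced_mem {k : ℕ} {X : Matrix (Fin k) (Fin k) (OSQuotient f hf)}
    (hX : X ∈ quotientCone f hf k) : X.map (induced f hf) ∈ cone k := by
  refine archimedean ?_ fun r hr => ?_
  · ext i j
    have := congrFun (congrFun hX.1 i) j
    rw [Matrix.star_apply] at this
    rw [Matrix.star_apply, Matrix.map_apply, Matrix.map_apply, ← induced_star, this]
  · obtain ⟨Y, hY, hYX⟩ := hX.2 r hr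
    have : X.map (induced f hf) + (r : ℂ) • Matrix.diagonal (fun _ => e) = Y.map f := by
      have h2 : Y.map f = (Y.map (mk f hf)).map (induced f hf) := rfl
      rw [h2, hYX]
      ext i j
      by_cases h : i = j <;> simp [quotientUnit, h, induced_mk, hf.1]
    rw [this]
    exact hf.2 k Y hY

/-- The operator system structure on the quotient by the kernel of a ucp map. -/
instance : OperatorSystem (OSQuotient f hf) where
  cone := quotientCone f hf
  e := mk f hf e
  star_eq_of_mem h := h.1
  add_mem {k X Y} hX hY := ⟨by rw [star_add, hX.1, hY.1], fun ε hε => by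
    have h := preCone_add (hX.2 (ε / 2) (half_pos hε)) (hY.2 (ε / 2) (half_pos hε))
    rwa [add_add_add_comm, ← add_smul, ← Complex.ofReal_add, add_halves] at h⟩
  smul_mem {k X t} ht hX := ⟨by rw [star_smul, hX.1]; simp, fun ε hε => by
    have ht' : 0 < t + 1 := by linarith
    have h := preCone_smul ht (hX.2 (ε / (t + 1)) (div_pos hε ht'))
    have h2 := preCone_add h (preCone_smul (t := ε / (t + 1)) (div_pos hε ht').le
      (unit_mem_preCone (f := f) (hf := hf) k))
    rw [smul_add, smul_smul, add_assoc, ← add_smul, ← Complex.ofReal_mul,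
      ← Complex.ofReal_add] at h2
    have e1 : t * (ε / (t + 1)) + ε / (t + 1) = ε := by field_simp
    rwa [e1] at h2⟩
  compression_mem {k m} A X hX := ⟨by rw [star_compression, hX.1], fun ε hε => by
    have hs : star (-compression A (unitMatrix S k)) = -compression A (unitMatrix S k) := by
      rw [star_neg, star_compression, star_unitMatrix]
    obtain ⟨c, hc, hcm⟩ := exists_add_mem hs
    have h1 := compression_mem_preCone A (hX.2 (ε / c) (div_pos hε hc))
    have h2 : (-compression A (quotientUnit f hf k) + (c : ℂ) • quotientUnit f hf m)
        ∈ preCone f hf m := by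
      refine ⟨_, hcm, ?_⟩
      rw [map_mk_add, map_mk_smul]
      change _ + (c : ℂ) • (unitMatrix S m).map _ = _
      rw [map_mk_unit, ← map_mk_unit f hf k, ← map_compression]
      ext i j; simp
    have h3 := preCone_add h1 (preCone_smul (div_pos hε hc).le h2)
    rw [compression_add, compression_smul, smul_add, smul_smul, ← Complex.ofReal_mul,
      div_mul_cancel₀ _ hc.ne', smul_neg, ← add_assoc, add_neg_cancel_right] at h3
    exact h3⟩
  eq_zero_of_mem_of_neg_mem {k X} h h' := by
    have h0 : X.map (induced f hf) = 0 := by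
      refine eq_zero_of_mem_of_neg_mem (map_induced_mem h) ?_
      have : -X.map (induced f hf) = (-X).map (induced f hf) := by ext i j; simp
      rw [this]
      exact map_induced_mem h'
    ext i j
    apply induced_injective f hf
    have := congrFun (congrFun h0 i) j
    simpa using this
  star_e := by rw [star_mk, OperatorSystem.star_e]
  exists_add_mem {k X} hX := by
    obtain ⟨Y, rfl⟩ := exists_map_mk f hf X
    let Z : Matrix (Fin k) (Fin k) S := (2⁻¹ : ℂ) • (Y + star Y)
    have hZ : star Z = Z := by simp [Z, add_comm]
    have hZY : Z.map (mk f hf) = Y.map (mk f hf) := by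
      rw [map_mk_smul, map_mk_add, map_mk_star, hX, ← two_smul ℂ, smul_smul,
        inv_mul_cancel₀ two_ne_zero, one_smul]
    obtain ⟨r, hr, h⟩ := exists_add_mem hZ
    refine ⟨r, hr, preCone_subset ⟨_, h, ?_⟩⟩
    rw [map_mk_add, map_mk_smul f hf (r : ℂ), hZY]
    change _ + (r : ℂ) • (unitMatrix S k).map _ = _
    rw [map_mk_unit]; rfl
  archimedean {k X} hX h := ⟨hX, fun ε hε => by
    have h1 := (h (ε / 2) (half_pos hε)).2 (ε / 2) (half_pos hε)
    change X + _ • quotientUnit f hf k + _ ∈ _ at h1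
    rwa [add_assoc, ← add_smul, ← Complex.ofReal_add, add_halves] at h1⟩

end OSQuotient

/-- Complete quotient maps: surjective ucp maps `f : S → T` for which the induced map
`S / ker f → T` is a complete order isomorphism. -/
def IsCompleteQuotientMap {S : Type u} [AddCommGroup S] [Module ℂ S] [StarAddMonoid S]
    [StarModule ℂ S] [OperatorSystem S] {T : Type v} [AddCommGroup T] [Module ℂ T]
    [StarAddMonoid T] [StarModule ℂ T] [OperatorSystem T] (f : S →ₗ[ℂ] T) : Prop :=
  ∃ hf : IsUCP f, Function.Surjective f ∧ IsCompleteOrderIso (OSQuotient.induced f hf)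

/-! ### `C*`-algebras as operator systems -/

namespace CStarAlgebra

variable {A : Type u} [CStarAlgebra A]

theorem nonneg_iff_exists [PartialOrder A] [StarOrderedRing A] {a : A} :
    0 ≤ a ↔ ∃ b, a = star b * b :=
  CStarAlgebra.nonneg_iff_eq_star_mul_self

theorem eq_star_mul_self_iff [PartialOrder A] [StarOrderedRing A] {k : ℕ}
    {X : Matrix (Fin k) (Fin k) A} :
    (∃ Y : Matrix (Fin k) (Fin k) A, X = star Y * Y) ↔ 0 ≤ CStarMatrix.ofMatrix X :=
  (nonneg_iff_exists (A := CStarMatrix (Fin k) (Fin k) A) (a := CStarMatrix.ofMatrix X)).symm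

theorem matrix_archimedean {k : ℕ} {X : Matrix (Fin k) (Fin k) A}
    (h : ∀ r : ℝ, 0 < r → ∃ Y : Matrix (Fin k) (Fin k) A,
      X + (r : ℂ) • Matrix.diagonal (fun _ => 1) = star Y * Y) :
    ∃ Y : Matrix (Fin k) (Fin k) A, X = star Y * Y := by
  let _ : PartialOrder A := CStarAlgebra.spectralOrder A
  have _ : StarOrderedRing A := CStarAlgebra.spectralOrderedRing A
  rw [eq_star_mul_self_iff]
  have h' : ∀ r : ℝ, 0 < r →
      0 ≤ CStarMatrix.ofMatrix X + (r : ℂ) • (1 : CStarMatrix (Fin k) (Fin k) A) :=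
    fun r hr => eq_star_mul_self_iff.mp (h r hr)
  have hc : Filter.Tendsto
      (fun r : ℝ => CStarMatrix.ofMatrix X + (r : ℂ) • (1 : CStarMatrix (Fin k) (Fin k) A))
      (nhdsWithin 0 (Set.Ioi 0)) (nhds (CStarMatrix.ofMatrix X + ((0 : ℝ) : ℂ) • 1)) := by
    have : Continuous (fun r : ℝ =>
        CStarMatrix.ofMatrix X + (r : ℂ) • (1 : CStarMatrix (Fin k) (Fin k) A)) := by
      fun_prop
    exact (this.tendsto 0).mono_left nhdsWithin_le_nhds
  rw [Complex.ofReal_zero, zero_smul, add_zero] at hc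
  refine ge_of_tendsto hc ?_
  filter_upwards [self_mem_nhdsWithin] with r hr using h' r hr

theorem matrix_exists_add {k : ℕ} {X : Matrix (Fin k) (Fin k) A} (hX : star X = X) :
    ∃ r : ℝ, 0 < r ∧ ∃ Y : Matrix (Fin k) (Fin k) A,
      X + (r : ℂ) • Matrix.diagonal (fun _ => 1) = star Y * Y := by
  let _ : PartialOrder A := CStarAlgebra.spectralOrder A
  have _ : StarOrderedRing A := CStarAlgebra.spectralOrderedRing A
  have hX' : IsSelfAdjoint (CStarMatrix.ofMatrix X) := hX
  refine ⟨‖CStarMatrix.ofMatrix X‖ + 1, by positivity, eq_star_mul_self_iff.mpr ?_⟩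
  have h1 := IsSelfAdjoint.neg_algebraMap_norm_le_self (a := CStarMatrix.ofMatrix X) hX'
  have h2 : 0 ≤ CStarMatrix.ofMatrix X
      + algebraMap ℝ (CStarMatrix (Fin k) (Fin k) A) ‖CStarMatrix.ofMatrix X‖ := by
    rw [← sub_nonneg, sub_neg_eq_add] at h1
    exact h1
  have h3 : (0 : CStarMatrix (Fin k) (Fin k) A) ≤ 1 := zero_le_one
  have h4 := add_nonneg h2 h3
  have h5 : CStarMatrix.ofMatrix
      (X + ((‖CStarMatrix.ofMatrix X‖ + 1 : ℝ) : ℂ) • Matrix.diagonal (fun _ => (1 : A)))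
      = CStarMatrix.ofMatrix X + algebraMap ℝ (CStarMatrix (Fin k) (Fin k) A)
        ‖CStarMatrix.ofMatrix X‖ + 1 := by
    rw [Complex.ofReal_add, add_smul, Complex.ofReal_one, one_smul, ← add_assoc,
      Algebra.algebraMap_eq_smul_one]
    rfl
  rw [h5]
  exact h4

theorem matrix_compression {k m : ℕ} (B : Matrix (Fin k) (Fin m) ℂ)
    (Y : Matrix (Fin k) (Fin k) A) :
    ∃ Z : Matrix (Fin m) (Fin m) A, compression B (star Y * Y) = star Z * Z := by
  let _ : PartialOrder A := CStarAlgebra.spectralOrder A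
  have _ : StarOrderedRing A := CStarAlgebra.spectralOrderedRing A
  cases m with
  | zero => exact ⟨0, Subsingleton.elim _ _⟩
  | succ m =>
    let D : Fin k → Matrix (Fin (m + 1)) (Fin (m + 1)) A := fun r i j =>
      if i = 0 then ∑ q, B q j • Y r q else 0
    have hD : ∀ r i j, (star (D r) * D r) i j
        = ∑ p, ∑ q, (star (B p i) * B q j) • (star (Y r p) * Y r q) := by
      intro r i j
      rw [Matrix.mul_apply, Finset.sum_eq_single 0]
      · change star (∑ p, B p i • Y r p) * (∑ q, B q j • Y r q) = _
        simp only [star_sum, Finset.sum_mul_sum, star_smul, smul_mul_smul_comm]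
      · intro b _ hb
        have : D r b j = 0 := if_neg hb
        rw [this, mul_zero]
      · simp
    have h1 : compression B (star Y * Y) = ∑ r, star (D r) * D r := by
      ext i j
      rw [Matrix.sum_apply]
      simp only [hD, compression, Matrix.mul_apply, Matrix.star_apply, Finset.smul_sum]
      rw [Finset.sum_comm (s := (Finset.univ : Finset (Fin k)))
        (f := fun r p => ∑ q, (star (B p i) * B q j) • (star (Y r p) * Y r q))]
      exact Finset.sum_congr rfl fun p _ => Finset.sum_comm
    rw [h1, eq_star_mul_self_iff]
    have h2 : 0 ≤ ∑ r, CStarMatrix.ofMatrix (star (D r) * D r) :=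
      Finset.sum_nonneg fun r _ => eq_star_mul_self_iff.mp ⟨D r, rfl⟩
    have h3 : CStarMatrix.ofMatrix (∑ r, star (D r) * D r)
        = ∑ r, CStarMatrix.ofMatrix (star (D r) * D r) :=
      map_sum (CStarMatrix.ofMatrixₗ (R := ℂ) (m := Fin (m + 1)) (n := Fin (m + 1)) (A := A)) _ _
    rw [h3]
    exact h2

/-- A unital `C*`-algebra `A` is an operator system: `X ∈ M_k(A)` is positive if and only if
`X = Y* Y` for some `Y ∈ M_k(A)`. -/
instance : OperatorSystem A where
  cone k := {X | ∃ Y : Matrix (Fin k) (Fin k) A, X = star Y * Y}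
  e := 1
  star_eq_of_mem {k X} h := by
    obtain ⟨Y, rfl⟩ := h
    rw [star_mul, star_star]
  add_mem {k X Y} hX hY := by
    let _ : PartialOrder A := CStarAlgebra.spectralOrder A
    have _ : StarOrderedRing A := CStarAlgebra.spectralOrderedRing A
    have h : 0 ≤ CStarMatrix.ofMatrix X + CStarMatrix.ofMatrix Y :=
      add_nonneg (eq_star_mul_self_iff.mp hX) (eq_star_mul_self_iff.mp hY)
    exact eq_star_mul_self_iff.mpr h
  smul_mem {k X t} ht h := by
    obtain ⟨Y, rfl⟩ := h
    refine ⟨((Real.sqrt t : ℝ) : ℂ) • Y, ?_⟩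
    rw [star_smul, smul_mul_smul_comm, RCLike.star_def, Complex.conj_ofReal,
      ← Complex.ofReal_mul, Real.mul_self_sqrt ht]
  compression_mem B X h := by
    obtain ⟨Y, rfl⟩ := h
    exact matrix_compression B Y
  eq_zero_of_mem_of_neg_mem {k X} h h' := by
    let _ : PartialOrder A := CStarAlgebra.spectralOrder A
    have _ : StarOrderedRing A := CStarAlgebra.spectralOrderedRing A
    have h1 := eq_star_mul_self_iff.mp h
    have h2 : 0 ≤ -CStarMatrix.ofMatrix X := eq_star_mul_self_iff.mp h'
    have h3 : CStarMatrix.ofMatrix X = 0 := le_antisymm (neg_nonneg.mp h2) h1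
    exact h3
  star_e := star_one A
  exists_add_mem hX := matrix_exists_add hX
  archimedean _ h := matrix_archimedean h

end CStarAlgebra

/-! ### `C*`-envelopes -/

/-- The pair `(C, j)` is a `C*`-envelope of the operator system `S`: `j : S → C` is a (unital)
complete order embedding into a unital `C*`-algebra whose range generates `C`, and for every such
pair `(A, ι)` there is a surjective unital `*`-homomorphism `ρ : A → C` with `ρ ∘ ι = j`. -/
def IsCStarEnvelope (S : Type u) [AddCommGroup S] [Module ℂ S] [StarAddMonoid S]
    [StarModule ℂ S] [OperatorSystem S] (C : Type v) [CStarAlgebra C] (j : S →ₗ[ℂ] C) : Prop :=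
  IsCompleteOrderEmbedding j ∧
  (StarAlgebra.adjoin ℂ (Set.range j)).topologicalClosure = ⊤ ∧
  ∀ (A : Type w) [CStarAlgebra A] (ι : S →ₗ[ℂ] A), IsCompleteOrderEmbedding ι →
    (StarAlgebra.adjoin ℂ (Set.range ι)).topologicalClosure = ⊤ →
    ∃ ρ : A →⋆ₐ[ℂ] C, Function.Surjective ρ ∧ ∀ s, ρ (ι s) = j s

namespace Brown

/-- The operator system `V_n ⊆ U_nc(n)` spanned by `1`, the `u_{ij}` and the `u_{ij}*`. -/
def V (n : ℕ) : OperatorSubsystem (Unc n) where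
  toSubmodule := Submodule.span ℂ ({1} ∪ (Set.range fun x : Fin n × Fin n => u n x.1 x.2) ∪
    Set.range fun x : Fin n × Fin n => star (u n x.1 x.2))
  star_mem' {x} hx := by
    change x ∈ Submodule.span ℂ _ at hx
    change star x ∈ Submodule.span ℂ _
    induction hx using Submodule.span_induction with
    | mem x hx =>
      apply Submodule.subset_span
      rcases hx with (hx | ⟨y, rfl⟩) | ⟨y, rfl⟩
      · rw [Set.mem_singleton_iff.mp hx, star_one]; exact Or.inl (Or.inl rfl)
      · exact Or.inr ⟨y, rfl⟩
      · exact Or.inl (Or.inr ⟨y, (star_star _).symm⟩)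
    | zero => rw [star_zero]; exact zero_mem _
    | add x y _ _ hx hy => rw [star_add]; exact Submodule.add_mem _ hx hy
    | smul c x _ hx => rw [star_smul]; exact Submodule.smul_mem _ _ hx
  e_mem' := Submodule.subset_span (Or.inl (Or.inl (Set.mem_singleton (1 : Unc n))))

/-- The element `1` of `V_n`. -/
def oneV (n : ℕ) : (V n).toSubmodule := ⟨1, (V n).e_mem'⟩

/-- The element `u_{ij}` of `V_n`. -/
def uV (n : ℕ) (i j : Fin n) : (V n).toSubmodule :=
  ⟨u n i j, Submodule.subset_span (Or.inl (Or.inr ⟨(i, j), rfl⟩))⟩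

/-- The `C*`-algebra `M_{2n}`; its rows and columns are indexed by two consecutive blocks of
length `n`. -/
abbrev M (n : ℕ) : Type := CStarMatrix (Fin n ⊕ Fin n) (Fin n ⊕ Fin n) ℂ

/-- The images of the matrix units `E_{ab}` of `M_{2n}` under `φ`. -/
def phiE (n : ℕ) : Fin n ⊕ Fin n → Fin n ⊕ Fin n → (V n).toSubmodule
  | .inl i, .inl j => if i = j then (1 / (2 * n) : ℂ) • oneV n else 0
  | .inr i, .inr j => if i = j then (1 / (2 * n) : ℂ) • oneV n else 0
  | .inl i, .inr j => (1 / (2 * n) : ℂ) • uV n i j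
  | .inr i, .inl j => (1 / (2 * n) : ℂ) • star (uV n j i)

/-- The linear map `φ : M_{2n} → V_n` with `φ(E_{ab}) = phiE n a b`. -/
def phi (n : ℕ) : M n →ₗ[ℂ] (V n).toSubmodule where
  toFun X := ∑ a, ∑ b, X a b • phiE n a b
  map_add' X Y := by simp [add_smul, Finset.sum_add_distrib]
  map_smul' c X := by simp [Finset.smul_sum, smul_smul]

end Brown

end

/-!
`V_n` is the image of `M_{2n}` under a map whose Choi matrix `(2n)⁻¹ [1 U]* [1 U]` is positive, so
`φ` is ucp and surjective. Both remaining assertions are proved by duality: an element of a matrix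
level of an operator system is positive as soon as all positive functionals are nonnegative at it
(`mem_cone_of_forall_isPositiveFunctional`), and positive functionals extend along complete order
embeddings (`IsCompleteOrderEmbedding.exists_extension`). Both facts are instances of the extension
theorem of M. Riesz, since the cones have order units.

*Complete quotient map.* It has to be shown that a positive functional on `M_k(M_{2n} / ker φ)` is
nonnegative at the elements that become positive in `M_k(V_n)`. Such a functional has a density
matrix, which is the Gram matrix of vectors `g_{a,p}` with `a ≤ 2n` and `p ≤ k`. As the functional
vanishes on `ker φ`, the first `n` families `g_a` are mutually orthogonal with equal Gram matrices,
and so are the last `n` families, with the same Gram matrix. In finite dimension, such families are obtained from vectors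
`e_i ⊗ d_p` by unitaries `R₁` and `R₂`, and the blocks of `R₁* R₂` form a unitary `n × n` matrix
of operators, i.e. a representation `π` of `U_nc(n)` (`exists_unitary_of_gram`). The functional is
then a multiple of `X ↦ ∑ ⟨d_p, π(φ(X_{pq})) d_q⟩` (`nonneg_of_map_induced_mem`).

*`C*`-envelope.* Let `ι : V_n → A` be a complete order embedding with generating range. The norm
of every noncommutative polynomial in the `ι(u_{ij})` and their adjoints is at least that of the
polynomial in the `u_{ij}` (`norm_toUnc_le`), so that `ι(u_{ij}) ↦ u_{ij}` extends to a
`*`-homomorphism `A → U_nc(n)`; its range is closed and dense. For the norm estimate, a positive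
functional `g` on `U_nc(n)` is transported to `A`: for the finitely many words `w` of bounded
length, the functional `X ↦ ∑ g(w* X_{w w'} w')` on the matrices over `V_n` extends to a positive
functional `G` on the matrices over `A`. The columns of `U` and `U*` are isometric and those of
their images under `ι` are contractive, hence `G(b* b) = 0` for
`b = ι(u_{ij}) ⊗ E_{w w} - 1 ⊗ E_{w, u_{ij} w}`, and by the Cauchy–Schwarz inequality letters can
be moved from the argument of `G` into the index (`IsUCP.apply_single_mul`). Thus the corner of
`G` at the empty word agrees with `g` on all words of bounded length. This argument replaces an
extension of ucp maps and their multiplicative domains, and needs no representation of `U_nc(n)`.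
-/

/-! ### Positive functionals on matrix levels of an operator system -/

/-- A cone with an order unit `e` is separated from every `z` for which some `z + ε e` lies outside
of it. The functional is the extension of `r e ↦ r` that is positive on the cone generated by `C`
and `-(z + ε e)`. -/
theorem PointedCone.exists_functional_neg {E : Type u} [AddCommGroup E] [Module ℝ E]
    (C : PointedCone ℝ E) {e z : E} (heC : e ∈ C) (he : ∀ y : E, ∃ r : ℝ, y + r • e ∈ C)
    {ε : ℝ} (hε : 0 < ε) (hz : z + ε • e ∉ C) :
    ∃ g : E →ₗ[ℝ] ℝ, (∀ x ∈ C, 0 ≤ g x) ∧ g z < 0 := by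
  have hsm : ∀ {t : ℝ} {x : E}, 0 ≤ t → x ∈ C → t • x ∈ C := fun ht hx => C.smul_mem ht hx
  have he' : -e ∉ C := fun h => by
    obtain ⟨r, hr⟩ := he (z + ε • e)
    apply hz
    rcases le_total 0 r with h0 | h0
    · have := C.add_mem hr (hsm h0 h)
      rwa [smul_neg, add_neg_cancel_right] at this
    · have := C.add_mem hr (hsm (neg_nonneg.mpr h0) heC)
      rwa [neg_smul, add_neg_cancel_right] at this
  have he0 : e ≠ 0 := by
    rintro rfl
    rw [neg_zero] at he'
    exact he' C.zero_mem
  let C' : PointedCone ℝ E :=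
    { carrier := {x | ∃ c ∈ C, ∃ t : ℝ, 0 ≤ t ∧ x = c - t • (z + ε • e)}
      zero_mem' := ⟨0, C.zero_mem, 0, le_rfl, by simp⟩
      add_mem' := by
        rintro _ _ ⟨c, hc, t, ht, rfl⟩ ⟨d, hd, s, hs, rfl⟩
        exact ⟨c + d, C.add_mem hc hd, t + s, add_nonneg ht hs, by rw [add_smul]; abel⟩
      smul_mem' := by
        rintro ⟨r, hr⟩ _ ⟨c, hc, t, ht, rfl⟩
        refine ⟨r • c, hsm hr hc, r * t, mul_nonneg hr ht, ?_⟩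
        change r • (c - t • (z + ε • e)) = _
        rw [smul_sub, smul_smul] }
  have hCC' : ∀ x ∈ C, x ∈ C' := fun x hx => ⟨x, hx, 0, le_rfl, by simp⟩
  obtain ⟨g, hg, hgC⟩ := riesz_extension C' (LinearPMap.mkSpanSingleton e (1 : ℝ) he0) (by
    rintro ⟨x, hx⟩ ⟨c, hc, t, ht, hxc⟩
    obtain ⟨r, rfl⟩ := Submodule.mem_span_singleton.mp hx
    have hr0 : LinearPMap.mkSpanSingleton e (1 : ℝ) he0 ⟨r • e, hx⟩ = r := by
      refine (LinearPMap.mkSpanSingleton'_apply _ _ _ _ _).trans ?_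
      simp
    rw [hr0]
    by_contra hr
    have hr' : r < 0 := not_le.mp hr
    change r • e = _ at hxc
    have h1 : t • (z + ε • e) = c + (-r) • e := by
      rw [neg_smul, hxc]; abel
    have h2 : c + (-r) • e ∈ C := C.add_mem hc (hsm (by linarith) heC)
    rcases ht.eq_or_lt with rfl | ht
    · rw [zero_smul] at h1
      have h3 : -e = (-r)⁻¹ • c := by
        rw [eq_neg_of_add_eq_zero_left h1.symm, smul_neg, smul_smul,
          inv_mul_cancel₀ (by linarith), one_smul]
      exact he' (h3 ▸ hsm (inv_nonneg.mpr (by linarith)) hc)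
    · have h3 : z + ε • e = t⁻¹ • (c + (-r) • e) := by
        rw [← h1, smul_smul, inv_mul_cancel₀ ht.ne', one_smul]
      exact hz (h3 ▸ hsm (inv_nonneg.mpr ht.le) h2)) (fun y => by
    obtain ⟨r, hr⟩ := he y
    exact ⟨⟨r • e, Submodule.mem_span_singleton.mpr ⟨r, rfl⟩⟩, by
      rw [add_comm]; exact hCC' _ hr⟩)
  refine ⟨g, fun x hx => hgC x (hCC' x hx), ?_⟩
  have h1 : g e = 1 := by
    have := hg ⟨e, Submodule.mem_span_singleton_self e⟩
    exact this.trans (LinearPMap.mkSpanSingleton_apply ℝ ℝ he0 (1 : ℝ))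
  have h2 := hgC (-(z + ε • e)) ⟨0, C.zero_mem, 1, zero_le_one, by simp⟩
  rw [map_neg, map_add, map_smul, h1, smul_eq_mul, mul_one] at h2
  linarith

namespace OperatorSystem

variable {S : Type u} [AddCommGroup S] [Module ℂ S] [StarAddMonoid S] [StarModule ℂ S]
  [OperatorSystem S]
  {T : Type v} [AddCommGroup T] [Module ℂ T] [StarAddMonoid T] [StarModule ℂ T]
  [OperatorSystem T]

variable (S) in
theorem zero_mem_cone (k : ℕ) : (0 : Matrix (Fin k) (Fin k) S) ∈ cone k := by
  have := smul_mem le_rfl (unitMatrix_mem (S := S) k)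
  rwa [Complex.ofReal_zero, zero_smul] at this

/-- The real-linear functionals on `M_k(S)` that are nonnegative on the positive cone and invariant
under the involution: the real parts of the positive functionals. -/
structure IsPositiveFunctional {k : ℕ} (g : Matrix (Fin k) (Fin k) S →ₗ[ℝ] ℝ) : Prop where
  nonneg : ∀ X ∈ cone k, 0 ≤ g X
  map_star : ∀ X, g (star X) = g X

variable (S) in
/-- The matrices whose real part is positive. -/
def realPartCone (k : ℕ) : PointedCone ℝ (Matrix (Fin k) (Fin k) S) where
  carrier := {X | X + star X ∈ cone k}
  zero_mem' := by
    change (0 : Matrix (Fin k) (Fin k) S) + star 0 ∈ cone k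
    rw [star_zero, add_zero]; exact zero_mem_cone S k
  add_mem' {X Y} hX hY := by
    change X + Y + star (X + Y) ∈ cone k
    rw [star_add, add_add_add_comm]; exact add_mem hX hY
  smul_mem' := by
    rintro ⟨r, hr⟩ X hX
    change (r • X : Matrix (Fin k) (Fin k) S) + star (r • X) ∈ cone k
    rw [← Complex.coe_smul, star_smul, RCLike.star_def, Complex.conj_ofReal, ← smul_add]
    exact smul_mem hr hX

theorem mem_realPartCone {k : ℕ} {X : Matrix (Fin k) (Fin k) S} :
    X ∈ realPartCone S k ↔ X + star X ∈ cone k := Iff.rfl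

theorem mem_realPartCone_of_mem {k : ℕ} {X : Matrix (Fin k) (Fin k) S} (hX : X ∈ cone k) :
    X ∈ realPartCone S k := by
  rw [mem_realPartCone, star_eq_of_mem hX]; exact add_mem hX hX

theorem mem_of_mem_realPartCone {k : ℕ} {X : Matrix (Fin k) (Fin k) S} (hX : star X = X)
    (h : X ∈ realPartCone S k) : X ∈ cone k := by
  rw [mem_realPartCone, hX, ← two_smul ℂ] at h
  have := smul_mem (t := 2⁻¹) (by norm_num) h
  rwa [smul_smul, Complex.ofReal_inv, Complex.ofReal_ofNat, inv_mul_cancel₀ two_ne_zero,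
    one_smul] at this

theorem isPositiveFunctional_iff {k : ℕ} {g : Matrix (Fin k) (Fin k) S →ₗ[ℝ] ℝ} :
    IsPositiveFunctional g ↔ ∀ X ∈ realPartCone S k, 0 ≤ g X := by
  refine ⟨fun h X hX => ?_, fun h => ⟨fun X hX => h X (mem_realPartCone_of_mem hX), fun X => ?_⟩⟩
  · have := h.nonneg _ hX
    rw [map_add, h.map_star] at this
    linarith
  · have key : ∀ Y : Matrix (Fin k) (Fin k) S, star Y = -Y → 0 ≤ g Y := fun Y hY =>
      h Y (by rw [mem_realPartCone, hY, add_neg_cancel]; exact zero_mem_cone S k)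
    have h1 := key (star X - X) (by simp)
    have h2 := key (X - star X) (by simp)
    rw [map_sub] at h1 h2
    linarith

theorem exists_add_smul_unitMatrix_mem_realPartCone {k : ℕ} (X : Matrix (Fin k) (Fin k) S) :
    ∃ r : ℝ, X + r • unitMatrix S k ∈ realPartCone S k := by
  obtain ⟨r, -, h⟩ := exists_add_mem (X := X + star X) (by simp [add_comm])
  refine ⟨r / 2, ?_⟩
  rw [mem_realPartCone, ← Complex.coe_smul, star_add, star_smul, star_unitMatrix, RCLike.star_def,
    Complex.conj_ofReal, add_add_add_comm, ← add_smul, ← Complex.ofReal_add, add_halves]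
  exact h

/-- The positive functionals detect the positive elements among the self-adjoint ones. -/
theorem mem_cone_of_forall_isPositiveFunctional {k : ℕ} {X : Matrix (Fin k) (Fin k) S}
    (hX : star X = X) (h : ∀ g : Matrix (Fin k) (Fin k) S →ₗ[ℝ] ℝ, IsPositiveFunctional g →
      0 ≤ g X) : X ∈ cone k := by
  refine archimedean hX fun r hr => ?_
  by_contra hr'
  obtain ⟨g, hg, hgX⟩ := (realPartCone S k).exists_functional_neg (z := X)
    (mem_realPartCone_of_mem (unitMatrix_mem k)) exists_add_smul_unitMatrix_mem_realPartCone hr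
    (fun hm => hr' (by
      rw [← Complex.coe_smul] at hm
      refine mem_of_mem_realPartCone (X := X + (r : ℂ) • unitMatrix S k) ?_ hm
      rw [star_add, hX, star_smul, star_unitMatrix, RCLike.star_def, Complex.conj_ofReal]))
  exact absurd (h g (isPositiveFunctional_iff.mpr hg)) (not_le.mpr hgX)

end OperatorSystem

open OperatorSystem

section Embedding

variable {S : Type u} [AddCommGroup S] [Module ℂ S] [StarAddMonoid S] [StarModule ℂ S]
  [OperatorSystem S]
  {T : Type v} [AddCommGroup T] [Module ℂ T] [StarAddMonoid T] [StarModule ℂ T]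
  [OperatorSystem T] {f : S →ₗ[ℂ] T}

theorem IsCompleteOrderEmbedding.isUCP (hf : IsCompleteOrderEmbedding f) : IsUCP f := by
  obtain ⟨T₁, h, g, hg, hg1, -⟩ := hf
  have hgf : ∀ x, ((g x : T₁.toSubmodule) : T) = f x := fun x =>
    congrArg Subtype.val (LinearMap.congr_fun hg x)
  refine ⟨?_, fun k X hX => ?_⟩
  · rw [← hgf]; exact congrArg Subtype.val hg1.1
  · have h1 : (X.map g).map (Subtype.val : _ → T) = X.map f := by
      ext i j; exact hgf _
    rw [← h1]; exact hg1.2 k X hX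

theorem IsCompleteOrderEmbedding.injective (hf : IsCompleteOrderEmbedding f) :
    Function.Injective f := by
  obtain ⟨T₁, h, g, hg, -, -⟩ := hf
  intro x y hxy
  apply g.injective
  apply Subtype.ext
  rw [show ((g x : T₁.toSubmodule) : T) = f x from congrArg Subtype.val (LinearMap.congr_fun hg x),
    show ((g y : T₁.toSubmodule) : T) = f y from congrArg Subtype.val (LinearMap.congr_fun hg y),
    hxy]

theorem IsCompleteOrderEmbedding.mem_cone_of_map_mem (hf : IsCompleteOrderEmbedding f) {k : ℕ}
    {X : Matrix (Fin k) (Fin k) S} (hX : X.map f ∈ cone k) : X ∈ cone k := by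
  obtain ⟨T₁, h, g, hg, -, hg2⟩ := hf
  have h1 : (X.map g).map (Subtype.val : _ → T) = X.map f := by
    ext i j; exact congrArg Subtype.val (LinearMap.congr_fun hg _)
  have h2 := hg2.2 k (X.map g) (by rw [← h1] at hX; exact hX)
  have h3 : (X.map g).map g.symm.toLinearMap = X := by ext i j; simp
  rwa [h3] at h2

theorem OperatorSubsystem.isCompleteOrderEmbedding_subtype (V : OperatorSubsystem S) :
    IsCompleteOrderEmbedding V.toSubmodule.subtype :=
  ⟨V, fun x => x.2, LinearEquiv.refl ℂ _, rfl, ⟨rfl, fun _ _ h => h⟩, ⟨rfl, fun _ _ h => h⟩⟩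

/-- Positive functionals extend along complete order embeddings. -/
theorem IsCompleteOrderEmbedding.exists_extension (hf : IsCompleteOrderEmbedding f) {k : ℕ}
    {g : Matrix (Fin k) (Fin k) S →ₗ[ℝ] ℝ} (hg : IsPositiveFunctional g) :
    ∃ G : Matrix (Fin k) (Fin k) T →ₗ[ℝ] ℝ, IsPositiveFunctional G ∧
      ∀ X : Matrix (Fin k) (Fin k) S, G (X.map f) = g X := by
  let F : Matrix (Fin k) (Fin k) S →ₗ[ℝ] Matrix (Fin k) (Fin k) T :=
    { toFun := fun X => X.map f
      map_add' := fun X Y => by ext i j; simp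
      map_smul' := fun r X => by
        ext i j
        simp only [Matrix.map_apply, Matrix.smul_apply, RingHom.id_apply, ← Complex.coe_smul,
          map_smul] }
  have hF : Function.Injective F := Matrix.map_injective hf.injective
  let p : Matrix (Fin k) (Fin k) T →ₗ.[ℝ] ℝ :=
    { domain := LinearMap.range F
      toFun := g ∘ₗ (LinearEquiv.ofInjective F hF).symm.toLinearMap }
  have hp : ∀ X, p ⟨F X, X, rfl⟩ = g X := fun X => by
    change g ((LinearEquiv.ofInjective F hF).symm _) = _
    congr 1
    exact (LinearEquiv.symm_apply_eq _).mpr (Subtype.ext rfl)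
  have hstar : ∀ X : Matrix (Fin k) (Fin k) S, F (star X) = star (F X) := fun X => by
    ext i j; exact hf.isUCP.map_star _
  obtain ⟨G, hG, hG'⟩ := riesz_extension (realPartCone T k) p (by
    rintro ⟨_, X, rfl⟩ hX
    rw [hp]
    refine isPositiveFunctional_iff.mp hg X (hf.mem_cone_of_map_mem ?_)
    change F (X + star X) ∈ _
    rw [map_add, hstar]
    exact hX) (fun Y => by
    obtain ⟨r, hr⟩ := exists_add_smul_unitMatrix_mem_realPartCone Y
    refine ⟨⟨F (r • unitMatrix S k), _, rfl⟩, ?_⟩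
    have : F (unitMatrix S k) = unitMatrix T k := hf.isUCP.map_unitMatrix k
    have h2 : Y + r • unitMatrix T k = F (r • unitMatrix S k) + Y := by
      rw [map_smul, this, add_comm]
    exact h2 ▸ hr)
  exact ⟨G, isPositiveFunctional_iff.mpr hG', fun X => (hG ⟨F X, X, rfl⟩).trans (hp X)⟩

end Embedding

/-! ### Multiplicativity of extended functionals on finitely many words -/

namespace OperatorSystem

variable {A : Type u} [CStarAlgebra A] {k : ℕ}

/-- If a positive functional vanishes at `b* b`, then it vanishes on the left ideal generated by
`b`, by the Cauchy–Schwarz inequality. -/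
theorem IsPositiveFunctional.apply_mul_eq_zero {G : Matrix (Fin k) (Fin k) A →ₗ[ℝ] ℝ}
    (hG : IsPositiveFunctional G) {b : Matrix (Fin k) (Fin k) A} (hb : G (star b * b) = 0)
    (x : Matrix (Fin k) (Fin k) A) : G (x * b) = 0 := by
  have h1 : ∀ t : ℝ, 0 ≤ 2 * t * G (x * b) + t ^ 2 * G (x * star x) := fun t => by
    have h := hG.nonneg (star (b + t • star x) * (b + t • star x)) ⟨_, rfl⟩
    have hst : star (b + t • star x) = star b + t • x := by
      ext i j
      simp [Matrix.star_apply]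
    have h2 : G (star b * star x) = G (x * b) := by
      rw [← hG.map_star, star_mul, star_star, star_star]
    rw [hst, add_mul, mul_add, mul_add] at h
    simp only [map_add, mul_smul_comm, smul_mul_assoc, map_smul, smul_eq_mul, hb, h2] at h
    linarith
  have h0 : 0 ≤ G (x * star x) := hG.nonneg _ ⟨star x, by rw [star_star]⟩
  -- A parameter at which the quadratic polynomial in `t` is negative unless `G (x * b) = 0`.
  have h2 := h1 (-(G (x * b) / (G (x * star x) + 1)))
  set s := G (x * b)
  set r := G (x * star x)
  have h3 : 2 * -(s / (r + 1)) * s + (-(s / (r + 1))) ^ 2 * r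
      = -(s ^ 2 * ((r + 2) / (r + 1) ^ 2)) := by
    field_simp; ring
  rw [h3] at h2
  have h4 : 0 < (r + 2) / (r + 1) ^ 2 := by positivity
  have h5 : s ^ 2 ≤ 0 := by
    by_contra h
    have := mul_pos (not_le.mp h) h4
    linarith
  exact pow_eq_zero_iff two_ne_zero |>.mp (le_antisymm h5 (sq_nonneg s))

end OperatorSystem

section Isometry

theorem Matrix.sum_star_mulVec_mul_mulVec {R : Type u} [Ring R] [StarRing R] {m : ℕ}
    (Y : Matrix (Fin m) (Fin m) R) (h : Fin m → R) :
    ∑ r, star (∑ q, Y r q * h q) * ∑ q, Y r q * h q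
      = ∑ p, ∑ q, star (h p) * (star Y * Y) p q * h q := by
  have h1 : ∀ r, star (∑ q, Y r q * h q) * ∑ q, Y r q * h q
      = ∑ p, ∑ q, star (Y r p * h p) * (Y r q * h q) := fun r => by
    rw [star_sum, Finset.sum_mul_sum]
  simp only [h1]
  rw [Finset.sum_comm]
  refine Finset.sum_congr rfl fun p _ => ?_
  rw [Finset.sum_comm]
  refine Finset.sum_congr rfl fun q _ => ?_
  rw [Matrix.mul_apply, Finset.mul_sum, Finset.sum_mul]
  simp only [star_mul, Matrix.star_apply, mul_assoc]

variable {C : Type u} [CStarAlgebra C] {V : OperatorSubsystem C} {A : Type v} [CStarAlgebra A]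
  {f : V.toSubmodule →ₗ[ℂ] A} {n : ℕ}

/-- A ucp map takes a column of elements that is an isometry to a column that is a contraction:
the image of the positive matrix `[c 1]* [c 1]` is positive, and so is its compression by
`(1, -f(c))`. -/
theorem IsUCP.exists_one_sub_sum_eq (hf : IsUCP f) {c : Fin n → V.toSubmodule}
    (hc : ∑ i, star (c i : C) * (c i : C) = 1) :
    ∃ (m : ℕ) (y : Fin m → A), 1 - ∑ i, star (f (c i)) * f (c i) = ∑ r, star (y r) * y r := by
  let X : Matrix (Fin (n + 1)) (Fin (n + 1)) V.toSubmodule := Matrix.of fun p q =>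
    Fin.cases (Fin.cases e (fun j => star (c j)) q)
      (fun i => Fin.cases (c i) (fun j => if i = j then e else 0) q) p
  let Y : Matrix (Fin (n + 1)) (Fin (n + 1)) C := Matrix.of fun p q =>
    Fin.cases 0 (fun i => Fin.cases (c i : C) (fun j => if i = j then 1 else 0) q) p
  have hX : X.map (Subtype.val : _ → C) = star Y * Y := by
    ext p q
    rw [Matrix.mul_apply, Fin.sum_univ_succ]
    refine Fin.cases ?_ (fun i => ?_) p <;> refine Fin.cases ?_ (fun j => ?_) q
    · simp only [X, Y, Matrix.map_apply, Matrix.of_apply, Matrix.star_apply, Fin.cases_zero,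
        Fin.cases_succ, mul_zero, zero_add, hc]
      rfl
    · simp [X, Y, Matrix.star_apply, OperatorSubsystem.coe_star]
    · simp [X, Y, Matrix.star_apply, apply_ite star]
    · simp only [X, Y, Matrix.map_apply, Matrix.of_apply, Matrix.star_apply, Fin.cases_zero,
        Fin.cases_succ, mul_zero, zero_add, apply_ite star, star_one, star_zero]
      by_cases h : i = j
      · subst h; simp; rfl
      · simp [h, Ne.symm h]
  obtain ⟨Z, hZ⟩ := hf.2 (n + 1) X ⟨Y, hX⟩
  let R : Fin (n + 1) → A := Fin.cons 1 fun i => -f (c i)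
  refine ⟨n + 1, fun r => ∑ q, Z r q * R q, ?_⟩
  have he : f e = 1 := hf.1
  rw [Matrix.sum_star_mulVec_mul_mulVec, ← hZ]
  simp only [Fin.sum_univ_succ, R, Fin.cons_zero, Fin.cons_succ, X, Matrix.map_apply,
    Matrix.of_apply, Fin.cases_zero, Fin.cases_succ, apply_ite f, map_zero, he, hf.map_star,
    star_one, one_mul, mul_one, star_neg, neg_mul, mul_neg, mul_ite, ite_mul, mul_zero,
    zero_mul, Finset.sum_ite_eq, Finset.mem_univ, if_true, Finset.sum_neg_distrib,
    Finset.sum_add_distrib]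
  abel

/-- The functional `X ↦ ∑ g(h_p* X_{pq} h_q)` on the matrices over an operator subsystem. -/
noncomputable def OperatorSubsystem.conjFunctional (V : OperatorSubsystem C) {k : ℕ}
    (g : C →ₗ[ℝ] ℝ) (h : Fin k → C) : Matrix (Fin k) (Fin k) V.toSubmodule →ₗ[ℝ] ℝ where
  toFun X := ∑ p, ∑ q, g (star (h p) * X p q * h q)
  map_add' X Y := by simp [mul_add, add_mul, Finset.sum_add_distrib]
  map_smul' r X := by simp [Finset.mul_sum]

theorem OperatorSubsystem.isPositiveFunctional_conjFunctional {k : ℕ} {g : C →ₗ[ℝ] ℝ}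
    (hg : ∀ y, 0 ≤ g (star y * y)) (hgs : ∀ y, g (star y) = g y) (h : Fin k → C) :
    IsPositiveFunctional (V.conjFunctional g h) where
  nonneg X hX := by
    obtain ⟨Y, hY⟩ := hX
    have h1 : V.conjFunctional g h X
        = ∑ r, g (star (∑ q, Y r q * h q) * ∑ q, Y r q * h q) := by
      rw [← map_sum, Matrix.sum_star_mulVec_mul_mulVec, ← hY]
      simp only [map_sum]
      rfl
    rw [h1]
    exact Finset.sum_nonneg fun r _ => hg _
  map_star X := by
    change ∑ p, ∑ q, g (star (h p) * star (X q p : C) * h q)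
      = ∑ p, ∑ q, g (star (h p) * (X p q : C) * h q)
    rw [Finset.sum_comm]
    refine Finset.sum_congr rfl fun p _ => Finset.sum_congr rfl fun q _ => ?_
    rw [← hgs (star (h p) * _ * h q)]
    simp [mul_assoc]

theorem OperatorSubsystem.apply_single_map_of_eq_conjFunctional {k : ℕ} {g : C →ₗ[ℝ] ℝ}
    {h : Fin k → C} {G : Matrix (Fin k) (Fin k) A →ₗ[ℝ] ℝ}
    (hGf : ∀ X : Matrix (Fin k) (Fin k) V.toSubmodule, G (X.map f) = V.conjFunctional g h X)
    (p q : Fin k) (v : V.toSubmodule) :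
    G (Matrix.single p q (f v)) = g (star (h p) * v * h q) := by
  have h1 : Matrix.single p q (f v) = (Matrix.single p q v).map f := by
    ext a b; simp [Matrix.single_apply, apply_ite f]
  rw [h1, hGf]
  change ∑ a, ∑ b, g (star (h a) * (Matrix.single p q v a b : V.toSubmodule) * h b) = _
  rw [Finset.sum_eq_single p, Finset.sum_eq_single q]
  · rw [Matrix.single_apply_same]
  · intro b _ hb
    rw [Matrix.single_apply_of_col_ne _ _ hb.symm]; simp
  · simp
  · intro a _ ha
    refine Finset.sum_eq_zero fun b _ => ?_
    rw [Matrix.single_apply_of_row_ne ha.symm]; simp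
  · simp

/-- Multiplicativity of an extension `G` of `conjFunctional g h` at an isometric column `c`: the
element `b = f(c_i) ⊗ E_{qq} - 1 ⊗ E_{q q_i}` satisfies `G(b* b) = 0`, because the sum over `i` of
these nonnegative numbers is at most `G((∑ f(c_i)* f(c_i) - 1) ⊗ E_{qq}) ≤ 0`. -/
theorem IsUCP.apply_single_mul (hf : IsUCP f) {k : ℕ} {g : C →ₗ[ℝ] ℝ} {h : Fin k → C}
    {G : Matrix (Fin k) (Fin k) A →ₗ[ℝ] ℝ} (hG : IsPositiveFunctional G)
    (hGf : ∀ X : Matrix (Fin k) (Fin k) V.toSubmodule, G (X.map f) = V.conjFunctional g h X)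
    {c : Fin n → V.toSubmodule} (hc : ∑ i, star (c i : C) * (c i : C) = 1) {q : Fin k}
    {q' : Fin n → Fin k} (hq : ∀ i, h (q' i) = c i * h q) (i : Fin n) (p : Fin k) (x : A) :
    G (Matrix.single p q (x * f (c i))) = G (Matrix.single p (q' i) x) := by
  have hstar : ∀ (p q : Fin k) (x : A),
      star (Matrix.single p q x) = Matrix.single q p (star x) := Matrix.conjTranspose_single
  have hV := fun p q v => V.apply_single_map_of_eq_conjFunctional hGf p q v
  let b : Fin n → Matrix (Fin k) (Fin k) A := fun i =>
    Matrix.single q q (f (c i)) - Matrix.single q (q' i) 1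
  have he : f e = 1 := hf.1
  have heC : ((e : V.toSubmodule) : C) = 1 := rfl
  have hb : ∀ i, G (star (b i) * b i) = G (Matrix.single q q (star (f (c i)) * f (c i)))
      - g (star (h q) * (star (c i : C) * c i) * h q) := fun i => by
    have h1 := hV q (q' i) (star (c i))
    have h2 := hV (q' i) q (c i)
    have h3 := hV (q' i) (q' i) e
    simp only [b, star_sub, hstar, sub_mul, mul_sub, Matrix.single_mul_single_same, map_sub,
      star_one, one_mul, mul_one, ← hf.map_star]
    rw [he] at h3
    rw [h1, h2, h3, hq, heC, OperatorSubsystem.coe_star]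
    simp only [star_mul, mul_one, mul_assoc]
    ring
  have hb0 : ∀ i, 0 ≤ G (star (b i) * b i) := fun i => hG.nonneg _ ⟨_, rfl⟩
  have hsum : ∑ i, G (star (b i) * b i) ≤ 0 := by
    obtain ⟨m, y, hy⟩ := hf.exists_one_sub_sum_eq hc
    have h1 : ∑ i, G (star (b i) * b i)
        = -G (Matrix.single q q (1 - ∑ i, star (f (c i)) * f (c i))) := by
      have h2 : ∀ z : Fin n → A, Matrix.single q q (∑ i, z i) = ∑ i, Matrix.single q q (z i) :=
        fun z => map_sum (Matrix.singleAddMonoidHom q q) z Finset.univ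
      have h3 : G (Matrix.single q q (1 : A)) = g (star (h q) * 1 * h q) := by
        rw [← he, hV q q e, heC]
      have h4 : Matrix.single q q (1 - ∑ i, star (f (c i)) * f (c i))
          = Matrix.single q q 1 - ∑ i, Matrix.single q q (star (f (c i)) * f (c i)) := by
        rw [← h2]
        exact map_sub (Matrix.singleAddMonoidHom q q) _ _
      simp only [hb, Finset.sum_sub_distrib]
      rw [h4, map_sub, h3, ← map_sum g, ← Finset.sum_mul, ← Finset.mul_sum, hc, map_sum G]
      ring
    have h2 : Matrix.single q q (∑ r, star (y r) * y r)
        = ∑ r, star (Matrix.single q q (y r)) * Matrix.single q q (y r) := by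
      simp only [hstar, Matrix.single_mul_single_same]
      exact map_sum (Matrix.singleAddMonoidHom q q) _ Finset.univ
    rw [h1, hy, h2, map_sum, neg_nonpos]
    exact Finset.sum_nonneg fun r _ => hG.nonneg _ ⟨_, rfl⟩
  have hbi : G (star (b i) * b i) = 0 :=
    (Finset.sum_eq_zero_iff_of_nonneg fun i _ => hb0 i).mp
      (le_antisymm hsum (Finset.sum_nonneg fun i _ => hb0 i)) i (Finset.mem_univ i)
  have := hG.apply_mul_eq_zero hbi (Matrix.single p q x)
  simp only [b, mul_sub, Matrix.single_mul_single_same, map_sub, mul_one] at this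
  exact sub_eq_zero.mp this

end Isometry

/-! ### Rigidity of the generators of Brown's algebra -/

theorem FreeStarAlgebra.map_mono {X : Type u} {B : Type v} [Ring B] [StarRing B] [Algebra ℂ B]
    [StarModule ℂ B] (φ : FreeStarAlgebra X →⋆ₐ[ℂ] B) (m : FreeMonoid (X ⊕ X)) (c : ℂ) :
    φ (mono m c)
      = c • (m.toList.map (Sum.elim (fun x => φ (gen x)) fun x => star (φ (gen x)))).prod := by
  have h1 : mono m c = c • mono m 1 := by rw [smul_mono, mul_one]
  rw [h1, map_smul]
  congr 1
  clear h1
  induction m using FreeMonoid.inductionOn' with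
  | one => exact map_one φ
  | of_mul x m ih =>
    have h2 : mono (FreeMonoid.of x * m) 1 = mono (FreeMonoid.of x) 1 * mono m 1 := by
      rw [mono_mul, mul_one]
    rw [h2, map_mul, ih, FreeMonoid.toList_of_mul, List.map_cons, List.prod_cons]
    congr 1
    cases x with
    | inl x => rfl
    | inr x =>
      have h3 : mono (FreeMonoid.of (Sum.inr x)) 1 = star (gen x) := by
        rw [gen, star_mono]; simp [wordStar]
      rw [h3, map_star]; rfl

/-- Additive functionals that agree on all multiples of short words agree on a given element of the
free `*`-algebra, once "short" is large enough. -/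
theorem FreeStarAlgebra.exists_length_bound {X : Type u} {B : Type v} [Ring B] [StarRing B]
    [Algebra ℂ B] [StarModule ℂ B] {C : Type w} [Ring C] [StarRing C] [Algebra ℂ C]
    [StarModule ℂ C] (φ : FreeStarAlgebra X →⋆ₐ[ℂ] B) (ψ : FreeStarAlgebra X →⋆ₐ[ℂ] C)
    (a : FreeStarAlgebra X) :
    ∃ L : ℕ, ∀ (G : B →+ ℝ) (g : C →+ ℝ),
      (∀ m c, m.toList.length ≤ L → G (φ (mono m c)) = g (ψ (mono m c))) →
        G (φ a) = g (ψ a) := by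
  refine induction_lin (P := fun a => ∃ L : ℕ, ∀ (G : B →+ ℝ) (g : C →+ ℝ),
      (∀ m c, m.toList.length ≤ L → G (φ (mono m c)) = g (ψ (mono m c))) →
        G (φ a) = g (ψ a)) ⟨0, ?_⟩ ?_ ?_ a
  · intro G g _
    rw [map_zero, map_zero, map_zero, map_zero]
  · rintro a b ⟨L, hL⟩ ⟨L', hL'⟩
    refine ⟨max L L', fun G g h => ?_⟩
    rw [map_add, map_add, map_add, map_add,
      hL G g fun m c hm => h m c (hm.trans (le_max_left _ _)),
      hL' G g fun m c hm => h m c (hm.trans (le_max_right _ _))]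
  · exact fun m c => ⟨m.toList.length, fun G g h => h m c le_rfl⟩

namespace Brown

variable {n : ℕ}

/-- The elements `u_{ij}` and `u_{ij}*` of `V_n`, as values of the letters `x_{ij}`, `x_{ij}*`. -/
noncomputable def letter (n : ℕ) : (Fin n × Fin n) ⊕ (Fin n × Fin n) → (V n).toSubmodule :=
  Sum.elim (fun x => uV n x.1 x.2) fun x => star (uV n x.1 x.2)

/-- Every letter belongs to an isometric column: a column of `U`, or one of `U*`. -/
theorem exists_column (l : (Fin n × Fin n) ⊕ (Fin n × Fin n)) :
    ∃ (c : Fin n → (Fin n × Fin n) ⊕ (Fin n × Fin n)) (i : Fin n), c i = l ∧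
      ∑ i, star (letter n (c i) : Unc n) * (letter n (c i) : Unc n) = 1 := by
  have hu := Unitary.mem_iff.mp (u_mem_unitary n)
  rcases l with ⟨i, j⟩ | ⟨i, j⟩
  · refine ⟨fun i' => Sum.inl (i', j), i, rfl, ?_⟩
    have := congrFun (congrFun hu.1 j) j
    rw [Matrix.mul_apply, Matrix.one_apply_eq] at this
    exact this
  · refine ⟨fun j' => Sum.inr (i, j'), j, rfl, ?_⟩
    have := congrFun (congrFun hu.2 i) i
    rw [Matrix.mul_apply, Matrix.one_apply_eq] at this
    rw [← this]
    refine Finset.sum_congr rfl fun j' _ => ?_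
    change star (star (u n i j')) * star (u n i j') = _
    rw [star_star]; rfl

section Words

variable {A : Type v} [CStarAlgebra A] {f : (V n).toSubmodule →ₗ[ℂ] A}

/-- Moving the letters of a word one by one from the argument into the index of a matrix unit. -/
theorem apply_single_mul_prod (hf : IsUCP f) {k L : ℕ} {g : Unc n →ₗ[ℝ] ℝ} {h : Fin k → Unc n}
    {G : Matrix (Fin k) (Fin k) A →ₗ[ℝ] ℝ} (hG : IsPositiveFunctional G)
    (hGf : ∀ X : Matrix (Fin k) (Fin k) (V n).toSubmodule,
      G (X.map f) = (V n).conjFunctional g h X)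
    {idx : List ((Fin n × Fin n) ⊕ (Fin n × Fin n)) → Fin k}
    (hidx : ∀ w, w.length ≤ L → h (idx w) = (w.map fun l => (letter n l : Unc n)).prod)
    (w w' : List ((Fin n × Fin n) ⊕ (Fin n × Fin n))) (hw : w.length + w'.length ≤ L)
    (p : Fin k) (x : A) :
    G (Matrix.single p (idx w') (x * (w.map fun l => f (letter n l)).prod))
      = G (Matrix.single p (idx (w ++ w')) x) := by
  induction w generalizing x with
  | nil => simp
  | cons l t ih =>
    rw [List.length_cons] at hw
    obtain ⟨c, i, rfl, hc⟩ := exists_column l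
    rw [List.map_cons, List.prod_cons, ← mul_assoc, ih (by omega)]
    refine hf.apply_single_mul hG hGf hc (q' := fun i => idx (c i :: t ++ w')) (fun i => ?_) i p x
    have hlen : (t ++ w').length = t.length + w'.length := List.length_append
    rw [hidx _ (by rw [List.cons_append, List.length_cons]; omega), hidx _ (by omega),
      List.cons_append, List.map_cons, List.prod_cons]

/-- A positive functional on `U_nc(n)` agrees, on a given element of the free `*`-algebra, with a
positive functional on a `C*`-algebra that contains `V_n` completely order isomorphically: extend
`conjFunctional g h`, where `h` lists the words of bounded length, and restrict to the corner of
the empty word. -/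
theorem exists_functional_eq (hf : IsCompleteOrderEmbedding f) {g : Unc n →ₗ[ℝ] ℝ}
    (hg : ∀ y, 0 ≤ g (star y * y)) (hgs : ∀ y, g (star y) = g y)
    (a : FreeStarAlgebra (Fin n × Fin n)) :
    ∃ G : A →+ ℝ, (∀ y, 0 ≤ G (star y * y)) ∧
      G (FreeStarAlgebra.lift (fun x => f (uV n x.1 x.2)) a) = g (toUnc n a) := by
  obtain ⟨L, hL⟩ := FreeStarAlgebra.exists_length_bound
    (FreeStarAlgebra.lift (fun x => f (uV n x.1 x.2))) (toUnc n) a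
  have hfin := List.finite_length_le ((Fin n × Fin n) ⊕ (Fin n × Fin n)) L
  obtain ⟨k, ⟨σ⟩⟩ := (Set.finite_coe_iff.mpr hfin).exists_equiv_fin
  let h : Fin k → Unc n := fun p => ((σ.symm p).1.map fun l => (letter n l : Unc n)).prod
  -- The index of a word; words of length greater than `L` do not matter.
  let idx : List ((Fin n × Fin n) ⊕ (Fin n × Fin n)) → Fin k := fun w =>
    if hw : w.length ≤ L then σ ⟨w, hw⟩ else σ ⟨[], Nat.zero_le L⟩
  have hidx : ∀ w, w.length ≤ L → h (idx w) = (w.map fun l => (letter n l : Unc n)).prod :=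
    fun w hw => by simp [h, idx, hw]
  obtain ⟨G, hG, hGf⟩ := hf.exists_extension
    ((V n).isPositiveFunctional_conjFunctional hg hgs h)
  have hucp := hf.isUCP
  refine ⟨G.toAddMonoidHom.comp (Matrix.singleAddMonoidHom (idx []) (idx [])), fun y => ?_,
    hL _ g.toAddMonoidHom fun m c hm => ?_⟩
  · change 0 ≤ G (Matrix.single _ _ _)
    refine hG.nonneg _ ⟨Matrix.single (idx []) (idx []) y, ?_⟩
    rw [Matrix.star_eq_conjTranspose, Matrix.conjTranspose_single, Matrix.single_mul_single_same]
  · change G (Matrix.single _ _ _) = g _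
    rw [FreeStarAlgebra.map_mono, FreeStarAlgebra.map_mono]
    have h1 : (Sum.elim
        (fun x => FreeStarAlgebra.lift (fun x => f (uV n x.1 x.2)) (FreeStarAlgebra.gen x))
        fun x => star (FreeStarAlgebra.lift (fun x => f (uV n x.1 x.2)) (FreeStarAlgebra.gen x)))
        = fun l => f (letter n l) := by
      funext l
      cases l with
      | inl x => exact FreeStarAlgebra.lift_gen _ x
      | inr x =>
        change star (FreeStarAlgebra.lift _ _) = f (star _)
        rw [FreeStarAlgebra.lift_gen, hucp.map_star]
    have h2 : (Sum.elim (fun x => toUnc n (FreeStarAlgebra.gen x))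
        fun x => star (toUnc n (FreeStarAlgebra.gen x))) = fun l => (letter n l : Unc n) := by
      funext l
      cases l <;> rfl
    have he : f e = 1 := hucp.1
    have h3 := apply_single_mul_prod hucp hG hGf hidx m.toList [] (by simpa using hm)
      (idx []) (f (c • e))
    rw [List.append_nil] at h3
    rw [h1, h2, ← one_mul (List.prod _), ← smul_mul_assoc, ← he, ← map_smul, h3]
    rw [(V n).apply_single_map_of_eq_conjFunctional hGf, hidx _ (by simp),
      hidx _ (by simpa using hm)]
    simp only [List.map_nil, List.prod_nil, star_one, one_mul, Submodule.coe_smul, smul_mul_assoc]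
    rw [show ((e : (V n).toSubmodule) : Unc n) = 1 from rfl, one_mul]

/-- The norm of `U_nc(n)` is the least among the norms of the `C*`-algebras that contain `V_n`
completely order isomorphically. -/
theorem norm_toUnc_le (hf : IsCompleteOrderEmbedding f) (a : FreeStarAlgebra (Fin n × Fin n)) :
    ‖toUnc n a‖ ≤ ‖FreeStarAlgebra.lift (fun x => f (uV n x.1 x.2)) a‖ := by
  let _ : PartialOrder (Unc n) := CStarAlgebra.spectralOrder _
  have _ : StarOrderedRing (Unc n) := CStarAlgebra.spectralOrderedRing _
  let _ : PartialOrder A := CStarAlgebra.spectralOrder _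
  have _ : StarOrderedRing A := CStarAlgebra.spectralOrderedRing _
  set φ := FreeStarAlgebra.lift (fun x : Fin n × Fin n => f (uV n x.1 x.2))
  let b : FreeStarAlgebra (Fin n × Fin n) :=
    algebraMap ℂ _ ((‖φ a‖ ^ 2 : ℝ) : ℂ) - star a * a
  have hstar : star (toUnc n b) = toUnc n b := by
    rw [← map_star]
    congr 1
    simp [b, Algebra.algebraMap_eq_smul_one]
  have hφb : ∃ y, φ b = star y * y := by
    rw [← CStarAlgebra.nonneg_iff_exists, map_sub, map_mul, map_star, sub_nonneg,
      AlgHomClass.commutes]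
    exact CStarAlgebra.star_mul_le_algebraMap_norm_sq
  -- Positive functionals of `U_nc(n)` are nonnegative at `‖φ a‖² - a* a`, because they agree there
  -- with a functional that is positive on `A`.
  have hcone : Matrix.diagonal (fun _ : Fin 1 => toUnc n b) ∈ cone 1 := by
    refine mem_cone_of_forall_isPositiveFunctional ?_ fun g hg => ?_
    · rw [Matrix.star_eq_conjTranspose, Matrix.diagonal_conjTranspose]
      congr 1; funext _; exact hstar
    let g' : Unc n →ₗ[ℝ] ℝ :=
      { toFun := fun y => g (Matrix.diagonal fun _ => y)
        map_add' := fun y z => by rw [← map_add, Matrix.diagonal_add]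
        map_smul' := fun r y => by
          rw [RingHom.id_apply, ← map_smul, ← Matrix.diagonal_smul]; rfl }
    obtain ⟨G, hG, hGb⟩ := exists_functional_eq hf (g := g') (fun y => by
      refine hg.nonneg _ ⟨Matrix.diagonal fun _ => y, ?_⟩
      rw [Matrix.star_eq_conjTranspose, Matrix.diagonal_conjTranspose, Matrix.diagonal_mul_diagonal]
      rfl) (fun y => by
      change g _ = g _
      rw [← hg.map_star (Matrix.diagonal _), Matrix.star_eq_conjTranspose,
        Matrix.diagonal_conjTranspose]
      congr 2; funext _; exact star_star y) b
    obtain ⟨y, hy⟩ := hφb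
    change 0 ≤ g' (toUnc n b)
    rw [← hGb, hy]
    exact hG y
  obtain ⟨Y, hY⟩ := hcone
  have h1 : toUnc n b = star (Y 0 0) * Y 0 0 := by
    have := congrFun (congrFun hY 0) 0
    rwa [Matrix.diagonal_apply_eq, Matrix.mul_apply, Fin.sum_univ_one] at this
  have h2 : star (toUnc n a) * toUnc n a ≤ algebraMap ℝ (Unc n) (‖φ a‖ ^ 2) := by
    have h3 := CStarAlgebra.nonneg_iff_exists.mpr ⟨_, h1⟩
    rw [map_sub, map_mul, map_star, sub_nonneg, AlgHomClass.commutes] at h3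
    exact h3
  rw [← CStarAlgebra.norm_le_iff_le_algebraMap _ (sq_nonneg _) (star_mul_self_nonneg _),
    CStarRing.norm_star_mul_self, ← sq] at h2
  exact (sq_le_sq₀ (norm_nonneg _) (norm_nonneg _)).mp h2

end Words

end Brown

/-! ### Ranges of `*`-homomorphisms -/

section Range

variable {A : Type u} [CStarAlgebra A] {B : Type v} [CStarAlgebra B]

/-- A self-adjoint element of the range of a `*`-homomorphism lifts without increase of the norm:
truncate the spectrum of a lift. -/
theorem StarAlgHom.exists_norm_le_of_isSelfAdjoint (φ : A →⋆ₐ[ℂ] B) {a : A}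
    (ha : IsSelfAdjoint a) : ∃ a', φ a' = φ a ∧ ‖a'‖ ≤ ‖φ a‖ := by
  let c : ℝ → ℝ := fun x => max (-‖φ a‖) (min x ‖φ a‖)
  have hc : Continuous c := by fun_prop
  have hφ : Continuous φ := by
    exact AddMonoidHomClass.continuous_of_bound φ 1
      (by simpa only [one_mul] using NonUnitalStarAlgHom.norm_apply_le φ)
  refine ⟨cfc c a, ?_, norm_cfc_le (norm_nonneg _) fun x _ => ?_⟩
  · rw [StarAlgHom.map_cfc φ c a hc.continuousOn hφ ha (ha.map φ)]
    conv_rhs => rw [← cfc_id' ℝ (φ a) (ha.map φ)]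
    refine cfc_congr fun x hx => ?_
    have : Nontrivial B := not_subsingleton_iff_nontrivial.mp fun h => by
      rw [spectrum.of_subsingleton] at hx
      exact hx
    have := abs_le.mp (spectrum.norm_le_norm_of_mem hx)
    simp [c, this.1, this.2]
  · exact abs_le.mpr ⟨le_max_left _ _,
      max_le ((neg_nonpos.mpr (norm_nonneg _)).trans (norm_nonneg _)) (min_le_right _ _)⟩

theorem StarAlgHom.exists_norm_le (φ : A →⋆ₐ[ℂ] B) (a : A) :
    ∃ a', φ a' = φ a ∧ ‖a'‖ ≤ 2 * ‖φ a‖ := by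
  have hr : ∀ (r : ℝ) (x : A), φ (r • x) = r • φ x := fun r x => by
    rw [← Complex.coe_smul, map_smul, Complex.coe_smul]
  have hre : φ (realPart a : A) = realPart (φ a) := by
    simp only [realPart_apply_coe, hr, map_add, map_star φ]
  have him : φ (imaginaryPart a : A) = imaginaryPart (φ a) := by
    simp only [imaginaryPart_apply_coe, hr, map_smul, map_sub, map_star φ]
  obtain ⟨x, hx, hx'⟩ := φ.exists_norm_le_of_isSelfAdjoint (realPart a).2
  obtain ⟨y, hy, hy'⟩ := φ.exists_norm_le_of_isSelfAdjoint (imaginaryPart a).2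
  refine ⟨x + Complex.I • y, ?_, ?_⟩
  · rw [map_add, map_smul, hx, hy, hre, him, realPart_add_I_smul_imaginaryPart]
  · rw [hre] at hx'
    rw [him] at hy'
    have h1 : ‖(realPart (φ a) : B)‖ ≤ ‖φ a‖ := realPart.norm_le (φ a)
    have h2 : ‖(imaginaryPart (φ a) : B)‖ ≤ ‖φ a‖ := imaginaryPart.norm_le (φ a)
    refine (norm_add_le _ _).trans ?_
    rw [norm_smul, Complex.norm_I, one_mul]
    linarith

/-- Ranges of `*`-homomorphisms between `C*`-algebras are closed. -/
theorem StarAlgHom.surjective_of_denseRange (φ : A →⋆ₐ[ℂ] B) (h : DenseRange φ) :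
    Function.Surjective φ := by
  let f : NormedAddGroupHom A B := AddMonoidHom.mkNormedAddGroupHom (φ : A →+ B) 1
    fun a => by rw [one_mul]; exact NonUnitalStarAlgHom.norm_apply_le φ a
  have h1 : f.SurjectiveOnWith f.range 2 := by
    rintro _ ⟨a, rfl⟩
    exact φ.exists_norm_le a
  intro b
  obtain ⟨a, ha, -⟩ := controlled_closure_of_complete two_pos one_pos h1 b (h b)
  exact ⟨a, ha⟩

end Range

/-! ### The `C*`-envelope of `V_n` -/

namespace Brown

variable {n : ℕ}

/-- A `C*`-algebra generated by a completely order isomorphic copy of `V_n` maps onto `U_nc(n)`: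
it is the completion of the free `*`-algebra in a norm that dominates that of `U_nc(n)`. -/
theorem exists_starAlgHom {A : Type v} [CStarAlgebra A] {f : (V n).toSubmodule →ₗ[ℂ] A}
    (hf : IsCompleteOrderEmbedding f)
    (hgen : (StarAlgebra.adjoin ℂ (Set.range f)).topologicalClosure = ⊤) :
    ∃ ρ : A →⋆ₐ[ℂ] Unc n, Function.Surjective ρ ∧ ∀ s, ρ (f s) = s := by
  let φ : FreeStarAlgebra (Fin n × Fin n) →⋆ₐ[ℂ] A :=
    FreeStarAlgebra.lift (fun x => f (uV n x.1 x.2))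
  have hφu : ∀ x, φ (FreeStarAlgebra.gen x) = f (uV n x.1 x.2) := FreeStarAlgebra.lift_gen _
  let p := CStarSeminorm.ofHom φ
  obtain ⟨α, hα⟩ := p.exists_extension φ fun _ => le_rfl
  obtain ⟨β, hβ⟩ := p.exists_extension (toUnc n) (norm_toUnc_le hf)
  have hαc : Continuous α := AddMonoidHomClass.continuous_of_bound α 1
      (by simpa only [one_mul] using NonUnitalStarAlgHom.norm_apply_le α)
  have hiso : ∀ x, ‖α x‖ = ‖x‖ := p.induction
    (isClosed_eq hαc.norm continuous_norm) fun a => by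
      rw [p.norm_ofPre]
      exact congrArg norm (hα a)
  have hinj : Function.Injective α := (injective_iff_map_eq_zero α).mpr fun x hx => by
    rw [← norm_eq_zero, ← hiso, hx, norm_zero]
  -- Every element of `V_n` is the value of a linear polynomial, which `f` respects.
  have hrange : ∀ s, ∃ a, φ a = f s ∧ toUnc n a = s := by
    rintro ⟨s, hs⟩
    refine Submodule.span_induction
      (p := fun s hs => ∃ a, φ a = f (⟨s, hs⟩ : (V n).toSubmodule) ∧ toUnc n a = s)
      ?_ ?_ ?_ ?_ hs
    · rintro _ ((rfl | ⟨x, rfl⟩) | ⟨x, rfl⟩)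
      · exact ⟨1, (map_one φ).trans hf.isUCP.1.symm, map_one _⟩
      · exact ⟨FreeStarAlgebra.gen x, hφu x, rfl⟩
      · refine ⟨star (FreeStarAlgebra.gen x), ?_, map_star _ _⟩
        rw [map_star, hφu, ← hf.isUCP.map_star]; rfl
    · exact ⟨0, (map_zero φ).trans (map_zero f).symm, map_zero _⟩
    · rintro s t hs ht ⟨a, ha, ha'⟩ ⟨b, hb, hb'⟩
      refine ⟨a + b, ?_, by rw [map_add, ha', hb']⟩
      rw [map_add, ha, hb, ← map_add]; rfl
    · rintro c s hs ⟨a, ha, ha'⟩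
      refine ⟨c • a, ?_, by rw [map_smul, ha']⟩
      rw [map_smul, ha, ← map_smul]; rfl
  have hdense : DenseRange α := by
    intro a
    have ha : a ∈ (StarAlgebra.adjoin ℂ (Set.range f)).topologicalClosure := by
      rw [hgen]; trivial
    have hle : StarAlgebra.adjoin ℂ (Set.range f) ≤ α.range := by
      refine StarAlgebra.adjoin_le ?_
      rintro _ ⟨s, rfl⟩
      obtain ⟨a, ha, -⟩ := hrange s
      exact ⟨p.ι a, (hα a).trans ha⟩
    exact closure_mono hle ha
  let σ := StarAlgEquiv.ofBijective α ⟨hinj, α.surjective_of_denseRange hdense⟩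
  have hσ : ∀ a, σ.symm (φ a) = p.ι a := fun a => by
    rw [← hα]; exact σ.symm_apply_apply _
  refine ⟨β.comp (σ.symm : A →⋆ₐ[ℂ] p.Completion), ?_, ?_⟩
  · refine StarAlgHom.surjective_of_denseRange _ ?_
    have hd : DenseRange (toUnc n) := (maxSeminorm n).denseRange_ofPre
    refine hd.mono ?_
    rintro _ ⟨a, rfl⟩
    exact ⟨φ a, (congrArg β (hσ a)).trans (hβ a)⟩
  · intro s
    obtain ⟨a, ha, ha'⟩ := hrange s
    rw [← ha, ← ha']
    exact (congrArg β (hσ a)).trans (hβ a)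

theorem isCStarEnvelope (n : ℕ) : IsCStarEnvelope.{0, 0, w} (V n).toSubmodule (Unc n)
    (V n).toSubmodule.subtype := by
  refine ⟨(V n).isCompleteOrderEmbedding_subtype, ?_, fun A _ ι hι hgen =>
    exists_starAlgHom hι hgen⟩
  rw [eq_top_iff, ← adjoin_u]
  refine StarSubalgebra.topologicalClosure_mono (StarAlgebra.adjoin_mono ?_)
  rintro _ ⟨x, rfl⟩
  exact ⟨uV n x.1 x.2, rfl⟩

end Brown

/-! ### Unitary matrices with prescribed inner products -/

/-- Two families of vectors with the same Gram matrix differ by an isometry. -/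
theorem LinearIsometry.exists_map_eq_of_inner_eq {E : Type u} [NormedAddCommGroup E]
    [InnerProductSpace ℂ E] [FiniteDimensional ℂ E] {κ : Type v} [Fintype κ] (x y : κ → E)
    (h : ∀ a b, inner ℂ (x a) (x b) = inner ℂ (y a) (y b)) :
    ∃ R : E →ₗᵢ[ℂ] E, ∀ a, R (x a) = y a := by
  classical
  let X := Fintype.linearCombination ℂ x
  let Y := Fintype.linearCombination ℂ y
  -- Hence `X c ↦ Y c` is a well-defined isometry on the span of `x`, which extends to `E`.
  have hnorm : ∀ c, ‖X c‖ = ‖Y c‖ := fun c => by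
    have h1 : inner ℂ (X c) (X c) = inner ℂ (Y c) (Y c) := by
      simp only [X, Y, Fintype.linearCombination_apply, sum_inner, inner_sum, inner_smul_left,
        inner_smul_right, h]
    rw [inner_self_eq_norm_sq_to_K, inner_self_eq_norm_sq_to_K] at h1
    have h2 : ‖X c‖ ^ 2 = ‖Y c‖ ^ 2 := by exact_mod_cast h1
    exact (sq_eq_sq₀ (norm_nonneg _) (norm_nonneg _)).mp h2
  obtain ⟨s, hs⟩ := X.rangeRestrict.exists_rightInverse_of_surjective
    (LinearMap.range_rangeRestrict X)
  have hs' : ∀ z : LinearMap.range X, X (s z) = z := fun z =>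
    congrArg Subtype.val (LinearMap.congr_fun hs z)
  let T : LinearMap.range X →ₗᵢ[ℂ] E :=
    { toLinearMap := Y ∘ₗ s
      norm_map' := fun z => by
        rw [LinearMap.comp_apply, ← hnorm, hs']; rfl }
  refine ⟨T.extend, fun a => ?_⟩
  have hxa : X (Pi.single a 1) = x a := by simp [X]
  have hya : Y (Pi.single a 1) = y a := by simp [Y]
  have h1 := T.extend_apply ⟨x a, _, hxa⟩
  refine h1.trans ?_
  change Y (s ⟨x a, _, hxa⟩) = y a
  rw [← hya, ← sub_eq_zero, ← map_sub, ← norm_eq_zero, ← hnorm, map_sub, hs', hxa, sub_self,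
    norm_zero]

/-- Let `d`, `g₁` and `g₂` be families of vectors such that the Gram matrices of `g₁` and of `g₂`
are that of `e_i ⊗ d_p`. Then the mutual inner products of `g₁` and `g₂` are the matrix
coefficients at `d` of a unitary matrix of operators: `W = R₁* R₂`, where the isometries `R₁`
and `R₂` map `e_i ⊗ d_p` to `g₁` and `g₂`. -/
theorem exists_unitary_of_gram {n k m : ℕ} (i₀ : Fin n) {d : Fin k → Fin m → ℂ}
    {g₁ g₂ : Fin n → Fin k → Fin m → ℂ}
    (h₁ : ∀ i j p q, star (g₁ i p) ⬝ᵥ g₁ j q = if i = j then star (d p) ⬝ᵥ d q else 0)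
    (h₂ : ∀ i j p q, star (g₂ i p) ⬝ᵥ g₂ j q = if i = j then star (d p) ⬝ᵥ d q else 0) :
    ∃ W ∈ unitary (Matrix (Fin n) (Fin n) (CStarMatrix (Fin m) (Fin m) ℂ)), ∀ i j p q,
      star (d p) ⬝ᵥ (CStarMatrix.ofMatrix.symm (W i j)).mulVec (d q)
        = star (g₁ i p) ⬝ᵥ g₂ j q := by
  -- The tensors `t i v = e_i ⊗ v`.
  let t : Fin n → (Fin m → ℂ) → EuclideanSpace ℂ (Fin n × Fin m) := fun i v =>
    ∑ r, v r • EuclideanSpace.single (i, r) 1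
  have ht : ∀ i j v w, inner ℂ (t i v) (t j w) = if i = j then star v ⬝ᵥ w else 0 := by
    intro i j v w
    have h0 : ∀ r s : Fin m, inner ℂ (EuclideanSpace.single (i, r) (1 : ℂ))
        (EuclideanSpace.single (j, s) (1 : ℂ)) = if i = j then (if r = s then 1 else 0) else 0 := by
      intro r s
      rw [EuclideanSpace.inner_single_left, PiLp.single_apply]
      by_cases hij : i = j <;> by_cases hrs : r = s <;> simp [hij, hrs]
    simp only [t, sum_inner, inner_sum, inner_smul_left, inner_smul_right, h0]
    by_cases hij : i = j
    · simp [hij, dotProduct, mul_comm]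
    · simp [hij]
  obtain ⟨R₁, hR₁⟩ := LinearIsometry.exists_map_eq_of_inner_eq
    (fun a : Fin n × Fin k => t a.1 (d a.2)) (fun a => t i₀ (g₁ a.1 a.2))
    (fun a b => by rw [ht, ht, h₁, if_pos rfl])
  obtain ⟨R₂, hR₂⟩ := LinearIsometry.exists_map_eq_of_inner_eq
    (fun a : Fin n × Fin k => t a.1 (d a.2)) (fun a => t i₀ (g₂ a.1 a.2))
    (fun a b => by rw [ht, ht, h₂, if_pos rfl])
  let b₁ := (EuclideanSpace.basisFun (Fin n × Fin m) ℂ).map (R₁.toLinearIsometryEquiv rfl)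
  let b₂ := (EuclideanSpace.basisFun (Fin n × Fin m) ℂ).map (R₂.toLinearIsometryEquiv rfl)
  have hb₁ : ∀ a, b₁ a = R₁ (EuclideanSpace.single a 1) := fun a => by simp [b₁]
  have hb₂ : ∀ a, b₂ a = R₂ (EuclideanSpace.single a 1) := fun a => by simp [b₂]
  let W : Matrix (Fin n) (Fin n) (CStarMatrix (Fin m) (Fin m) ℂ) := fun i j =>
    CStarMatrix.ofMatrix fun r s => inner ℂ (b₁ (i, r)) (b₂ (j, s))
  have hone : ∀ (b : OrthonormalBasis (Fin n × Fin m) ℂ (EuclideanSpace ℂ (Fin n × Fin m)))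
      (i j : Fin n) (r s : Fin m), inner ℂ (b (i, r)) (b (j, s))
        = (1 : Matrix (Fin n) (Fin n) (CStarMatrix (Fin m) (Fin m) ℂ)) i j r s := by
    intro b i j r s
    rw [OrthonormalBasis.inner_eq_ite]
    by_cases hij : i = j
    · subst hij
      rw [Matrix.one_apply_eq, CStarMatrix.one_apply]
      simp
    · simp [hij]
  have hsum : ∀ (F : Fin n → CStarMatrix (Fin m) (Fin m) ℂ) r s,
      (∑ x, F x) r s = ∑ x, F x r s := fun F r s => Matrix.sum_apply r s Finset.univ F
  refine ⟨W, Unitary.mem_iff.mpr ⟨?_, ?_⟩, ?_⟩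
  · ext i j r s
    rw [← hone b₂, ← b₁.sum_inner_mul_inner, Fintype.sum_prod_type]
    rw [Matrix.mul_apply, hsum]
    refine Finset.sum_congr rfl fun x _ => ?_
    rw [CStarMatrix.mul_apply]
    refine Finset.sum_congr rfl fun y _ => ?_
    rw [Matrix.star_apply, CStarMatrix.star_apply]
    congr 1
    exact inner_conj_symm (𝕜 := ℂ) (b₂ (i, r)) (b₁ (x, y))
  · ext i j r s
    rw [← hone b₁, ← b₂.sum_inner_mul_inner, Fintype.sum_prod_type]
    rw [Matrix.mul_apply, hsum]
    refine Finset.sum_congr rfl fun x _ => ?_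
    rw [CStarMatrix.mul_apply]
    refine Finset.sum_congr rfl fun y _ => ?_
    rw [Matrix.star_apply, CStarMatrix.star_apply]
    congr 1
    exact inner_conj_symm (𝕜 := ℂ) (b₂ (x, y)) (b₁ (j, s))
  · intro i j p q
    have h1 : inner ℂ (R₁ (t i (d p))) (R₂ (t j (d q))) = star (g₁ i p) ⬝ᵥ g₂ j q := by
      rw [hR₁ (i, p), hR₂ (j, q), ht, if_pos rfl]
    rw [← h1]
    simp only [t, map_sum, map_smul, sum_inner, inner_sum, inner_smul_left, inner_smul_right,
      ← hb₁, ← hb₂, dotProduct, Matrix.mulVec, Finset.mul_sum]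
    rw [Finset.sum_comm]
    refine Finset.sum_congr rfl fun s _ => Finset.sum_congr rfl fun r _ => ?_
    change star (d p r) * (inner ℂ (b₁ (i, r)) (b₂ (j, s)) * d q s) = _
    rw [RCLike.star_def]
    ring

/-! ### Complete positivity of `φ` -/

theorem OperatorSystem.sum_mem {S : Type u} [AddCommGroup S] [Module ℂ S] [StarAddMonoid S]
    [StarModule ℂ S] [OperatorSystem S] {k : ℕ} {κ : Type v} (s : Finset κ)
    {X : κ → Matrix (Fin k) (Fin k) S} (hX : ∀ i, X i ∈ cone k) : ∑ i ∈ s, X i ∈ cone k :=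
  Finset.sum_induction X (· ∈ cone k) (fun _ _ => add_mem) (zero_mem_cone S k) fun i _ => hX i

theorem CStarAlgebra.gram_mem_cone {A : Type u} [CStarAlgebra A] {k : ℕ} (v : Fin k → A) :
    (Matrix.of fun p q => star (v p) * v q) ∈ cone k := by
  cases k with
  | zero => exact ⟨0, Subsingleton.elim _ _⟩
  | succ k =>
    refine ⟨Matrix.of fun r q => if r = 0 then v q else 0, ?_⟩
    ext p q
    rw [Matrix.mul_apply, Finset.sum_eq_single 0]
    · simp [Matrix.star_apply]
    · intro b _ hb; simp [hb]
    · simp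

namespace Brown

variable {n : ℕ}

/-- The rows of the `n × 2n` matrix `[1 U]`. -/
noncomputable def oneU (n : ℕ) (c : Fin n) : Fin n ⊕ Fin n → Unc n :=
  Sum.elim (fun i => if c = i then 1 else 0) fun j => u n c j

/-- The Choi matrix `(φ(E_{ab}))` is `(2n)⁻¹ [1 U]* [1 U]`. -/
theorem coe_phiE (a b : Fin n ⊕ Fin n) : (phiE n a b : Unc n)
    = (1 / (2 * n) : ℂ) • ∑ c, star (oneU n c a) * oneU n c b := by
  have hu := (Unitary.mem_iff.mp (u_mem_unitary n)).1
  rcases a with i | i <;> rcases b with j | j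
  · have : ∑ c, star (oneU n c (Sum.inl i)) * oneU n c (Sum.inl j) = if i = j then 1 else 0 := by
      simp [oneU, apply_ite star, eq_comm]
    rw [this, phiE]
    by_cases h : i = j
    · simp only [h, if_true]; rfl
    · simp [h]
  · have : ∑ c, star (oneU n c (Sum.inl i)) * oneU n c (Sum.inr j) = u n i j := by
      simp [oneU, apply_ite star]
    rw [this]; rfl
  · have : ∑ c, star (oneU n c (Sum.inr i)) * oneU n c (Sum.inl j) = star (u n j i) := by
      simp [oneU]
    rw [this]; rfl
  · have : ∑ c, star (oneU n c (Sum.inr i)) * oneU n c (Sum.inr j) = if i = j then 1 else 0 := by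
      have h := congrFun (congrFun hu i) j
      rw [Matrix.mul_apply, Matrix.one_apply] at h
      exact h
    rw [this, phiE]
    by_cases h : i = j
    · simp only [h, if_true]; rfl
    · simp [h]

theorem coe_phi (X : M n) : (phi n X : Unc n) = ∑ a, ∑ b, X a b • (phiE n a b : Unc n) := by
  change ((∑ a, ∑ b, X a b • phiE n a b : (V n).toSubmodule) : Unc n) = _
  simp

/-- The matrix unit `E_{ab}` of `M_{2n}`. -/
def matUnit (n : ℕ) (a b : Fin n ⊕ Fin n) : M n := CStarMatrix.ofMatrix (Matrix.single a b 1)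

theorem phi_matUnit (a b : Fin n ⊕ Fin n) : phi n (matUnit n a b) = phiE n a b := by
  change ∑ a', ∑ b', Matrix.single a b (1 : ℂ) a' b' • phiE n a' b' = _
  rw [Finset.sum_eq_single a, Finset.sum_eq_single b]
  · simp
  · intro b' _ hb
    rw [Matrix.single_apply_of_col_ne _ _ hb.symm, zero_smul]
  · simp
  · intro a' _ ha
    exact Finset.sum_eq_zero fun b' _ => by
      rw [Matrix.single_apply_of_row_ne ha.symm, zero_smul]
  · simp

theorem eq_sum_smul_matUnit (X : M n) : X = ∑ a, ∑ b, X a b • matUnit n a b := by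
  have h := Matrix.matrix_eq_sum_single (CStarMatrix.ofMatrix.symm X)
  have h1 : ∀ a b, Matrix.single a b (X a b) = X a b • Matrix.single a b (1 : ℂ) := fun a b => by
    rw [Matrix.smul_single, smul_eq_mul, mul_one]
  refine h.trans ?_
  exact Finset.sum_congr rfl fun a _ => Finset.sum_congr rfl fun b _ => h1 a b

theorem phi_one (hn : 1 ≤ n) : phi n 1 = oneV n := by
  have hn' : (n : ℂ) ≠ 0 := Nat.cast_ne_zero.mpr (by omega)
  change ∑ a, ∑ b, (1 : Matrix (Fin n ⊕ Fin n) (Fin n ⊕ Fin n) ℂ) a b • phiE n a b = _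
  simp only [Matrix.one_apply, ite_smul, one_smul, zero_smul, Finset.sum_ite_eq, Finset.mem_univ,
    if_true, Fintype.sum_sum_type, phiE, Finset.sum_const, Finset.card_univ, Fintype.card_fin]
  rw [← Nat.cast_smul_eq_nsmul ℂ, smul_smul, ← add_smul]
  have : (n : ℂ) * (1 / (2 * n)) + n * (1 / (2 * n)) = 1 := by field_simp; norm_num
  rw [this, one_smul]

theorem isUCP_phi (hn : 1 ≤ n) : IsUCP (phi n) := by
  refine ⟨phi_one hn, fun k X hX => ?_⟩
  obtain ⟨Y, rfl⟩ := hX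
  let v : Fin k × (Fin n ⊕ Fin n) × Fin n → Fin k → Unc n := fun s q =>
    ∑ b, Y s.1 q s.2.1 b • oneU n s.2.2 b
  have hsum : ∀ (F : Fin k → M n) a b, (∑ x, F x) a b = ∑ x, F x a b :=
    fun F a b => Matrix.sum_apply a b Finset.univ F
  have hterm : ∀ p q a b, (star Y * Y) p q a b • (phiE n a b : Unc n) = ((1 / (2 * n) : ℝ) : ℂ) •
      ∑ s : Fin k × (Fin n ⊕ Fin n) × Fin n, (star (Y s.1 p s.2.1 a) * Y s.1 q s.2.1 b) •
        (star (oneU n s.2.2 a) * oneU n s.2.2 b) := fun p q a b => by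
    rw [coe_phiE, smul_comm, Matrix.mul_apply, hsum, Finset.sum_smul, Fintype.sum_prod_type]
    congr 1
    · push_cast; rfl
    refine Finset.sum_congr rfl fun r _ => ?_
    rw [CStarMatrix.mul_apply, Finset.sum_smul, Fintype.sum_prod_type]
    refine Finset.sum_congr rfl fun d _ => ?_
    rw [Finset.smul_sum]
    rfl
  have h1 : ((star Y * Y).map (phi n)).map (Subtype.val : _ → Unc n)
      = ((1 / (2 * n) : ℝ) : ℂ) • ∑ s, Matrix.of fun p q => star (v s p) * v s q := by
    ext p q
    rw [Matrix.map_apply, Matrix.map_apply, coe_phi, Matrix.smul_apply, Matrix.sum_apply]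
    simp only [hterm, ← Finset.smul_sum]
    congr 1
    rw [Finset.sum_congr rfl fun a _ => Finset.sum_comm, Finset.sum_comm]
    refine Finset.sum_congr rfl fun s _ => ?_
    simp only [Matrix.of_apply, v, star_sum, Finset.sum_mul_sum, star_smul, smul_mul_smul_comm]
  change ((star Y * Y).map (phi n)).map (Subtype.val : _ → Unc n) ∈ cone k
  rw [h1]
  exact smul_mem (by positivity) (sum_mem _ fun s => CStarAlgebra.gram_mem_cone _)

theorem phi_surjective (hn : 1 ≤ n) : Function.Surjective (phi n) := by
  have hn' : (2 * n : ℂ) ≠ 0 := mul_ne_zero two_ne_zero (Nat.cast_ne_zero.mpr (by omega))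
  have hE : ∀ (a b) (v : (V n).toSubmodule), phiE n a b = (1 / (2 * n) : ℂ) • v →
      v ∈ LinearMap.range (phi n) := fun a b v h =>
    ⟨(2 * n : ℂ) • matUnit n a b, by
      rw [map_smul, phi_matUnit, h, smul_smul, mul_one_div_cancel hn', one_smul]⟩
  rintro ⟨s, hs⟩
  refine Submodule.span_induction
    (p := fun s hs => (⟨s, hs⟩ : (V n).toSubmodule) ∈ LinearMap.range (phi n))
    ?_ ?_ ?_ ?_ hs
  · rintro _ ((rfl | ⟨x, rfl⟩) | ⟨x, rfl⟩)
    · exact ⟨1, phi_one hn⟩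
    · exact hE (.inl x.1) (.inr x.2) _ rfl
    · exact hE (.inr x.2) (.inl x.1) _ rfl
  · exact zero_mem _
  · exact fun s t hs ht h1 h2 => Submodule.add_mem _ h1 h2
  · exact fun c s hs h => Submodule.smul_mem _ c h

end Brown

/-! ### The quotient of `M_{2n}` -/

/-- A positive functional is the real part of a complex-linear one. -/
theorem OperatorSystem.IsPositiveFunctional.exists_complex {S : Type u} [AddCommGroup S]
    [Module ℂ S] [StarAddMonoid S] [StarModule ℂ S] [OperatorSystem S] {k : ℕ}
    {g : Matrix (Fin k) (Fin k) S →ₗ[ℝ] ℝ} (hg : IsPositiveFunctional g) :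
    ∃ H : Matrix (Fin k) (Fin k) S →ₗ[ℂ] ℂ, (∀ X, (H X).re = g X) ∧
      (∀ X, H (star X) = star (H X)) ∧ ∀ X ∈ cone k, 0 ≤ H X := by
  let H : Matrix (Fin k) (Fin k) S →ₗ[ℂ] ℂ := Module.Dual.extendRCLike g
  have hH : ∀ X, H X = (g X : ℂ) - Complex.I * (g (Complex.I • X) : ℂ) := fun X =>
    Module.Dual.extendRCLike_apply g X
  have hre : ∀ X, (H X).re = g X := fun X => by simp [hH]
  have hstar : ∀ X, H (star X) = star (H X) := fun X => by
    have h1 : g (Complex.I • star X) = -g (Complex.I • X) := by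
      rw [← hg.map_star, star_smul, star_star, RCLike.star_def, Complex.conj_I, neg_smul, map_neg]
    rw [hH, hH, h1, hg.map_star]
    apply Complex.ext <;> simp
  refine ⟨H, hre, hstar, fun X hX => ?_⟩
  have h1 := hstar X
  rw [star_eq_of_mem hX] at h1
  rw [Complex.nonneg_iff, hre]
  exact ⟨hg.nonneg X hX, (Complex.conj_eq_iff_im.mp h1.symm).symm⟩

theorem Matrix.PosSemidef.exists_gram {κ : Type u} [Finite κ] {D : Matrix κ κ ℂ}
    (hD : D.PosSemidef) : ∃ (m : ℕ) (g : κ → Fin m → ℂ), ∀ a b, D a b = star (g a) ⬝ᵥ g b := by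
  obtain ⟨m, v, rfl⟩ := Matrix.posSemidef_iff_eq_sum_vecMulVec.mp hD
  refine ⟨m, fun a s => star (v s a), fun a b => ?_⟩
  rw [Matrix.sum_apply]
  simp [dotProduct, Matrix.vecMulVec_apply]

namespace Brown

variable {n : ℕ}

/-- A positive functional on `M_k(M_{2n} / ker φ)` is nonnegative at the preimages of positive
elements of `M_k(V_n)`: its density matrix is a multiple of the matrix of the vector functionals
`⟨d_p, π(φ(E_{ab})) d_q⟩` of a representation `π` of `U_nc(n)`. -/
theorem nonneg_of_map_induced_mem (hn : 1 ≤ n) (hf : IsUCP (phi n)) {k : ℕ}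
    {g : Matrix (Fin k) (Fin k) (OSQuotient (phi n) hf) →ₗ[ℝ] ℝ} (hg : IsPositiveFunctional g)
    {X : Matrix (Fin k) (Fin k) (OSQuotient (phi n) hf)}
    (hX : X.map (OSQuotient.induced (phi n) hf) ∈ cone k) : 0 ≤ g X := by
  have hn' : (2 * n : ℂ) ≠ 0 := mul_ne_zero two_ne_zero (Nat.cast_ne_zero.mpr (by omega))
  let i₀ : Fin n := ⟨0, hn⟩
  obtain ⟨H, hre, hHstar, hHnonneg⟩ := hg.exists_complex
  let mk := OSQuotient.mk (phi n) hf
  have hmk : ∀ x y, phi n x = phi n y → mk x = mk y := fun x y h =>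
    OSQuotient.induced_injective (phi n) hf h
  let D : Matrix ((Fin n ⊕ Fin n) × Fin k) ((Fin n ⊕ Fin n) × Fin k) ℂ := fun x y =>
    H (Matrix.single x.2 y.2 (mk (matUnit n x.1 y.1)))
  -- The density matrix of `H` in terms of representatives in `M_{2n}`.
  have hHD : ∀ Z : Matrix (Fin k) (Fin k) (M n), H (Z.map mk)
      = ∑ p, ∑ q, ∑ a, ∑ b, Z p q a b * D (a, p) (b, q) := fun Z => by
    have h1 : ∀ p q, Matrix.single p q (mk (Z p q))
        = ∑ a, ∑ b, Z p q a b • Matrix.single p q (mk (matUnit n a b)) := fun p q => by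
      conv_lhs => rw [eq_sum_smul_matUnit (Z p q)]
      simp only [map_sum, map_smul, Matrix.smul_single]
      have h2 : ∀ (κ : Type) [Fintype κ] (z : κ → OSQuotient (phi n) hf),
          Matrix.single p q (∑ x, z x) = ∑ x, Matrix.single p q (z x) := fun κ _ z =>
        map_sum (Matrix.singleAddMonoidHom p q) z Finset.univ
      simp only [h2]
    conv_lhs => rw [Matrix.matrix_eq_sum_single (Z.map mk)]
    simp only [Matrix.map_apply, h1, map_sum, map_smul, smul_eq_mul, D]
  have hDstar : ∀ x y, star (D x y) = D y x := fun x y => by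
    change star (H _) = H _
    rw [← hHstar, Matrix.star_eq_conjTranspose, Matrix.conjTranspose_single]
    congr 2
    change star (OSQuotient.mk (phi n) hf _) = OSQuotient.mk (phi n) hf _
    rw [OSQuotient.star_mk]
    congr 1
    exact (Matrix.conjTranspose_single _ _ _).trans (by rw [star_one]; rfl)
  have hD : D.PosSemidef := by
    refine Matrix.PosSemidef.of_dotProduct_mulVec_nonneg (Matrix.ext fun x y => hDstar y x)
      fun x => ?_
    -- The form at `x` is the value of `H` at the positive matrix `(y_p* y_q)`, where the only
    -- nonzero row of `y_q` is `x(·, q)`.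
    let y : Fin k → M n := fun q => CStarMatrix.ofMatrix fun d b =>
      if d = Sum.inl i₀ then x (b, q) else 0
    have hy₀ : ∀ q c b, y q c b = if c = Sum.inl i₀ then x (b, q) else 0 := fun _ _ _ => rfl
    have hy : ∀ p q a b, (star (y p) * y q) a b = star (x (a, p)) * x (b, q) := fun p q a b => by
      rw [CStarMatrix.mul_apply, Finset.sum_eq_single (Sum.inl i₀)]
      · simp [hy₀, CStarMatrix.star_apply]
      · intro c _ hc; simp [hy₀, hc]
      · simp
    have h1 := hHnonneg ((Matrix.of fun p q => star (y p) * y q).map mk)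
      (OSQuotient.preCone_subset ⟨_, CStarAlgebra.gram_mem_cone y, rfl⟩)
    rw [hHD] at h1
    convert h1 using 1
    simp only [Matrix.of_apply, hy, dotProduct, Matrix.mulVec, Fintype.sum_prod_type,
      Finset.mul_sum, Pi.star_apply]
    rw [Finset.sum_comm]
    refine Finset.sum_congr rfl fun p _ => ?_
    rw [Finset.sum_congr rfl fun a _ => Finset.sum_comm, Finset.sum_comm]
    refine Finset.sum_congr rfl fun q _ => Finset.sum_congr rfl fun a _ =>
      Finset.sum_congr rfl fun b _ => ?_
    ring
  obtain ⟨m, v, hv⟩ := hD.exists_gram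
  -- The diagonal blocks of `D` are those of `1 ⊗ D₀`, because `H` factors through `φ`.
  have hD₁ : ∀ i j p q, D (.inl i, p) (.inl j, q)
      = if i = j then D (.inl i₀, p) (.inl i₀, q) else 0 := fun i j p q => by
    by_cases h : i = j
    · rw [if_pos h]
      change H _ = H _
      rw [hmk (matUnit n (.inl i) (.inl j)) (matUnit n (.inl i₀) (.inl i₀))
        (by simp [phi_matUnit, phiE, h])]
    · rw [if_neg h]
      change H _ = _
      rw [hmk (matUnit n (.inl i) (.inl j)) 0 (by simp [phi_matUnit, phiE, h])]
      simp
  have hD₂ : ∀ i j p q, D (.inr i, p) (.inr j, q)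
      = if i = j then D (.inl i₀, p) (.inl i₀, q) else 0 := fun i j p q => by
    by_cases h : i = j
    · rw [if_pos h]
      change H _ = H _
      rw [hmk (matUnit n (.inr i) (.inr j)) (matUnit n (.inl i₀) (.inl i₀))
        (by simp [phi_matUnit, phiE, h])]
    · rw [if_neg h]
      change H _ = _
      rw [hmk (matUnit n (.inr i) (.inr j)) 0 (by simp [phi_matUnit, phiE, h])]
      simp
  let d : Fin k → Fin m → ℂ := fun p => v (.inl i₀, p)
  obtain ⟨W, hW, hWD⟩ := exists_unitary_of_gram i₀ (d := d) (g₁ := fun i p => v (.inl i, p))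
    (g₂ := fun i p => v (.inr i, p)) (fun i j p q => by rw [← hv, ← hv, hD₁])
    (fun i j p q => by rw [← hv, ← hv, hD₂])
  obtain ⟨π, hπ⟩ := exists_lift hW
  let π' : Unc n →⋆ₐ[ℂ] Matrix (Fin m) (Fin m) ℂ :=
    ((CStarMatrix.ofMatrixStarAlgEquiv (n := Fin m) (A := ℂ)).symm :
      CStarMatrix (Fin m) (Fin m) ℂ →⋆ₐ[ℂ] Matrix (Fin m) (Fin m) ℂ).comp π
  have hπ' : ∀ i j, π' (u n i j) = CStarMatrix.ofMatrix.symm (W i j) := fun i j =>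
    congrArg CStarMatrix.ofMatrix.symm (hπ i j)
  -- The matrix coefficients of `π` at `d` reproduce the density matrix.
  let ω : Fin k → Fin k → Unc n →ₗ[ℂ] ℂ := fun p q =>
    { toFun := fun x => star (d p) ⬝ᵥ (π' x).mulVec (d q)
      map_add' := fun x y => by rw [map_add, Matrix.add_mulVec, dotProduct_add]
      map_smul' := fun c x => by
        rw [map_smul, Matrix.smul_mulVec, dotProduct_smul]; rfl }
  have hωu : ∀ i j p q, ω p q (u n i j) = D (.inl i, p) (.inr j, q) := fun i j p q => by
    change star (d p) ⬝ᵥ (π' (u n i j)).mulVec (d q) = _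
    rw [hπ', hWD, ← hv]
  have hωstar : ∀ p q x, ω p q (star x) = star (ω q p x) := fun p q x => by
    change star (d p) ⬝ᵥ (π' (star x)).mulVec (d q) = star (star (d q) ⬝ᵥ (π' x).mulVec (d p))
    rw [map_star, Matrix.star_dotProduct, Matrix.star_eq_conjTranspose, Matrix.star_mulVec,
      Matrix.conjTranspose_conjTranspose, Matrix.dotProduct_mulVec]
  have hω1 : ∀ p q, ω p q 1 = D (.inl i₀, p) (.inl i₀, q) := fun p q => by
    change star (d p) ⬝ᵥ (π' 1).mulVec (d q) = _
    rw [map_one, Matrix.one_mulVec, ← hv]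
  have hωD : ∀ a b p q, ω p q (phiE n a b) = (1 / (2 * n) : ℂ) * D (a, p) (b, q) := by
    intro a b p q
    rcases a with i | i <;> rcases b with j | j
    · rw [hD₁]
      by_cases h : i = j
      · simp only [phiE, h, if_true, Submodule.coe_smul, map_smul, smul_eq_mul]
        rw [← hω1]; rfl
      · simp [phiE, h]
    · simp only [phiE, Submodule.coe_smul, map_smul, smul_eq_mul]
      rw [← hωu]; rfl
    · simp only [phiE, Submodule.coe_smul, map_smul, smul_eq_mul]
      rw [← hDstar, ← hωu, ← hωstar]; rfl
    · rw [hD₂]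
      by_cases h : i = j
      · simp only [phiE, h, if_true, Submodule.coe_smul, map_smul, smul_eq_mul]
        rw [← hω1]; rfl
      · simp [phiE, h]
  obtain ⟨Z, rfl⟩ := OSQuotient.exists_map_mk (phi n) hf X
  obtain ⟨Y, hY⟩ := hX
  have hZY : ∀ p q, (phi n (Z p q) : Unc n) = ∑ r, star (Y r p) * Y r q := fun p q => by
    have := congrFun (congrFun hY p) q
    rw [Matrix.mul_apply] at this
    exact this
  have h1 : H (Z.map mk) = 2 * n * ∑ p, ∑ q, ω p q (phi n (Z p q)) := by
    simp only [hHD, coe_phi, map_sum, map_smul, smul_eq_mul, hωD, Finset.mul_sum]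
    refine Finset.sum_congr rfl fun p _ => Finset.sum_congr rfl fun q _ =>
      Finset.sum_congr rfl fun a _ => Finset.sum_congr rfl fun b _ => ?_
    field_simp
  have h2 : ∑ p, ∑ q, ω p q (phi n (Z p q))
      = ∑ r, star (∑ q, (π' (Y r q)).mulVec (d q)) ⬝ᵥ ∑ q, (π' (Y r q)).mulVec (d q) := by
    have h3 : ∀ p q r, ω p q (star (Y r p) * Y r q)
        = star ((π' (Y r p)).mulVec (d p)) ⬝ᵥ (π' (Y r q)).mulVec (d q) := fun p q r => by
      change star (d p) ⬝ᵥ (π' (star (Y r p) * Y r q)).mulVec (d q) = _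
      rw [map_mul, map_star, ← Matrix.mulVec_mulVec, Matrix.dotProduct_mulVec,
        Matrix.star_mulVec]
      rfl
    simp only [hZY, map_sum, h3, star_sum, sum_dotProduct, dotProduct_sum]
    rw [Finset.sum_congr rfl fun p _ => Finset.sum_comm, Finset.sum_comm]
    exact Finset.sum_congr rfl fun r _ => Finset.sum_comm
  have h3 : 0 ≤ H (Z.map mk) := by
    rw [h1, h2]
    refine mul_nonneg (by exact_mod_cast Nat.zero_le (2 * n)) (Finset.sum_nonneg fun r _ => ?_)
    exact dotProduct_star_self_nonneg _
  rw [← hre]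
  exact (Complex.nonneg_iff.mp h3).1

theorem isCompleteQuotientMap_phi (hn : 1 ≤ n) : IsCompleteQuotientMap (phi n) := by
  have hf := isUCP_phi hn
  have hs := phi_surjective hn
  have hbij : Function.Bijective (OSQuotient.induced (phi n) hf) :=
    ⟨OSQuotient.induced_injective _ hf, fun y => by
      obtain ⟨x, rfl⟩ := hs y
      exact ⟨OSQuotient.mk (phi n) hf x, rfl⟩⟩
  let F := LinearEquiv.ofBijective (OSQuotient.induced (phi n) hf) hbij
  have hF : ∀ x, F x = OSQuotient.induced (phi n) hf x := fun _ => rfl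
  refine ⟨hf, hs, F, rfl, ⟨hf.1, fun k X hX => OSQuotient.map_induced_mem hX⟩,
    (F.symm_apply_eq).mpr hf.1.symm, fun k X hX => ?_⟩
  have hFX : (X.map F.symm).map (OSQuotient.induced (phi n) hf) = X := by
    ext i j
    exact congrArg Subtype.val (F.apply_symm_apply (X i j))
  refine mem_cone_of_forall_isPositiveFunctional ?_ fun g hg =>
    nonneg_of_map_induced_mem hn hf hg (by rw [← hFX] at hX; exact hX)
  ext i j
  apply hbij.1
  rw [Matrix.star_apply, OSQuotient.induced_star]
  have h1 := congrFun (congrFun (star_eq_of_mem hX) i) j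
  rw [Matrix.star_apply] at h1
  change star (F (F.symm (X j i))) = F (F.symm (X i j))
  rw [F.apply_symm_apply, F.apply_symm_apply, h1]

end Brown

theorem mainTheorem3 (n : ℕ) (hn : 1 ≤ n) :
    IsCompleteQuotientMap (Brown.phi n) ∧
    IsCStarEnvelope.{0, 0, w} (Brown.V n).toSubmodule (Brown.Unc n)
      (Brown.V n).toSubmodule.subtype :=
  ⟨Brown.isCompleteQuotientMap_phi hn, Brown.isCStarEnvelope n⟩
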